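/- Let $n\ge 1$, let $F$ be a field of characteristic $0$, and let $v,l\in F$ be algebraically independent over $\mathbb Q$ (for instance $F=\mathbb Q(v,l)$, the quotient field of $\mathbb Q[v^{\pm1},l^{\pm1}]$). Put $m=v-v^{-1}$ and $\tau=\frac{l-l^{-1}}{m}+1$. Write $[ab\ldots]_N$ (resp. $[\ldots ab]_N$) for the alternating product of $a$ and $b$ with $N$ factors that begins with $a$ (resp. ends with $b$). Let $B=B_{I_2(2n+1)}(m,l)$ be the unital associative $F$-algebra generated by $X_0^{\pm1},X_1^{\pm1},E_0,E_1$ with the relations ($i\in\{0,1\}$, $1\le k\le n$) $$[X_0X_1\ldots]_{2n+1}=[X_1X_0\ldots]_{2n+1},\quad X_i-X_i^{-1}=m(E_i-1),\quad X_iE_i=E_iX_i=lE_i,\quad E_i^2=\tau E_i,$$ $$E_i[X_{1-i}X_i\ldots]_{2k-1}E_i=l^{-1}E_i,\qquad E_i[X_{1-i}^{-1}X_i^{-1}\ldots]_{2k-1}E_i=lE_i,$$ $$[X_0X_1\ldots]_{2n}E_0=E_1[X_0X_1\ldots]_{2n},\qquad E_0[X_1X_0\ldots]_{2n}=[X_1X_0\ldots]_{2n}E_1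 .$$ Let $H=H_{I_2(2n+1)}(v)$ be the dihedral Hecke algebra over $F$, generated by $x_0,x_1$ with the relations $[x_0x_1\ldots]_{2n+1}=[x_1x_0\ldots]_{2n+1}$ and $(x_i+v)(x_i-v^{-1})=0$. Let $\pi:B\to H$ be the algebra homomorphism with $\pi(X_i)=x_i$ and $\pi(E_i)=0$. On both algebras let $*$ be the $F$-linear anti-involution that reverses words in the generators (in the letters $X_i^{\pm1},E_i$, respectively $x_i$). A cell datum (Graham–Lehrer) on an $F$-algebra $A$ is a tuple $(\Lambda,M,C,*)$, where $\Lambda$ is a poset, $M(\lambda)$ is a finite set for each $\lambda\in\Lambda$, and $C:\coprod_{\lambda}M(\lambda)\times M(\lambda)\to A$, written $(S,T)\mapsto C^\lambda_{S,T}$, is injective with image an $F$-basis of $A$; $*$ is an $F$-linear anti-involution of $A$ with $(C^\lambda_{S,T})^*=C^\lambda_{T,S}$; and for all $a\in A$, $\lambda\in\Lambda$ there are $r_a(S',S)\in F$, independent of $T$, such that $aC^\lambda_{S,T}-\sum_{S'\in M(\lambda)}r_a(S',S)C^\lambda_{S',T}$ lies in the span of the $C^\mu_{P,Q}$ with $\mu<\lambda$.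 An algebra with a cell datum is called cellular. 1. Let $(\Lambda',M',C',*)$ be any cell datum on $H$ whose anti-involution is word reversal. Let $\Lambda=\Lambda'\sqcup\{\lambda_{LK}\}$ with the order of $\Lambda'$ and $\lambda_{LK}<\lambda$ for all $\lambda\in\Lambda'$; let $M(\lambda)=M'(\lambda)$ for $\lambda\in\Lambda'$ and $M(\lambda_{LK})=\{0,1,\ldots,2n\}$. Choose a total order on each $M'(\lambda)$ and, for $S\le T$ in $M'(\lambda)$, any $D^\lambda_{S,T}\in\pi^{-1}(C'^{\lambda}_{S,T})$; put $C^\lambda_{S,T}=D^\lambda_{S,T}$ if $S<T$, $C^\lambda_{S,T}=(D^\lambda_{T,S})^*$ if $T<S$, and $C^\lambda_{S,S}=\frac12\bigl(D^\lambda_{S,S}+(D^\lambda_{S,S})^*\bigr)$. For $0\le i,j\le 2n$ put $$C^{\lambda_{LK}}_{i,j}=[\ldots X_0X_1]_i\,E_0\,[X_1X_0\ldots]_j .$$ Then $(\Lambda,M,C,*)$, with $*$ the word reversal of $B$, is a cell datum on $B$, and $\pi(C^\lambda_{S,T})=C'^{\lambda}_{S,T}$ for all $\lambda\in\Lambda'$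 and $S,T\in M'(\lambda)$. 2. If moreover $F$ contains $\zeta+\zeta^{-1}$ for some primitive $(2n+1)$-st root of unity $\zeta$ in an algebraic closure of $F$, then $H$ has a cell datum whose anti-involution is word reversal; hence $B$ is a cellular algebra with word reversal as its anti-involution. -/

import Mathlib

namespace DihedralBMW

universe u w

section Cellular

variable {R : Type*} [CommRing R] {A : Type*} [Ring A] [Algebra R A]

/-- The data `(Λ, M, C, star)` form a cell datum (in the sense of Graham and Lehrer) on the
`R`-algebra `A`: `Λ` is a partially ordered set, every `M μ` is a finite set, and
* (C1) `(μ, S, T) ↦ C μ S T` is injective and its image is an `R`-basis of `A`;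
* (C2) `star` is an `R`-linear anti-involution of `A` with `star (C μ S T) = C μ T S`;
* (C3) `a * C μ S T ≡ ∑ S', r S' S • C μ S' T` modulo the span of the `C κ P Q` with `κ < μ`,
  where the coefficients `r S' S` do not depend on `T`. -/
structure IsCellDatum (Λ : Type*) [PartialOrder Λ] (M : Λ → Type*) [∀ μ, Fintype (M μ)]
    (C : ∀ μ, M μ → M μ → A) (star : A →ₗ[R] A) : Prop where
  injective : Function.Injective
    (fun x : (Σ μ : Λ, M μ × M μ) => C x.1 x.2.1 x.2.2)
  linearIndependent : LinearIndependent R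
    (fun x : (Σ μ : Λ, M μ × M μ) => C x.1 x.2.1 x.2.2)
  span_eq_top : Submodule.span R
    (Set.range (fun x : (Σ μ : Λ, M μ × M μ) => C x.1 x.2.1 x.2.2)) = ⊤
  star_mul : ∀ a b : A, star (a * b) = star b * star a
  star_star : ∀ a : A, star (star a) = a
  star_C : ∀ (μ : Λ) (S T : M μ), star (C μ S T) = C μ T S
  mul_C : ∀ (a : A) (μ : Λ), ∃ r : M μ → M μ → R, ∀ S T : M μ,
    a * C μ S T - ∑ S' : M μ, r S' S • C μ S' T ∈
      Submodule.span R {x : A | ∃ κ : Λ, κ < μ ∧ ∃ P Q : M κ, x = C κ P Q}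

/-- `A` is a cellular algebra, with `star` as the anti-involution of a cell datum. -/
def IsCellularWith (star : A →ₗ[R] A) : Prop :=
  ∃ (Λ : Type) (_ : PartialOrder Λ) (M : Λ → Type) (_ : ∀ μ, Fintype (M μ))
    (C : ∀ μ, M μ → M μ → A), IsCellDatum Λ M C star

end Cellular

section Words

variable {A : Type*} [Monoid A]

/-- `[a b a ⋯]_N`: the alternating product with `N` factors whose first factor is `a`. -/
def altL : A → A → ℕ → A
  | _, _, 0 => 1
  | a, b, N + 1 => a * altL b a N

/-- `[⋯ b a b]_N`: the alternating product of `a` and `b` with `N` factors whose last factor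
is `b`. -/
def altR : A → A → ℕ → A
  | _, _, 0 => 1
  | a, b, N + 1 => altR b a N * b

theorem map_altL {B F : Type*} [Monoid B] [FunLike F A B] [MonoidHomClass F A B] (f : F)
    (a b : A) (N : ℕ) : f (altL a b N) = altL (f a) (f b) N := by
  induction N generalizing a b with
  | zero => simp [altL]
  | succ N ih => simp [altL, ih]

theorem altL_op (a b : A) (N : ℕ) :
    altL (MulOpposite.op a) (MulOpposite.op b) N = MulOpposite.op (altR b a N) := by
  induction N generalizing a b with
  | zero => simp [altL, altR]
  | succ N ih => simp [altL, altR, ih]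

theorem altR_aux (a b : A) (k : ℕ) :
    altR a b (2 * k) = altL a b (2 * k) ∧ altR b a (2 * k + 1) = altL a b (2 * k + 1) := by
  have hL : ∀ (k : ℕ) (a b : A), altL a b (2 * k) * a = altL a b (2 * k + 1) ∧
      altL a b (2 * k + 1) * b = altL a b (2 * (k + 1)) := by
    intro k
    induction k with
    | zero => intro a b; simp [altL]
    | succ k ih =>
      intro a b
      have h1 : altL a b (2 * (k + 1)) * a = altL a b (2 * (k + 1) + 1) := by
        have := (ih b a).2
        change a * altL b a (2 * k + 1) * a = a * altL b a (2 * (k + 1))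
        rw [mul_assoc, this]
      refine ⟨h1, ?_⟩
      have h2 : altL b a (2 * (k + 1)) * b = altL b a (2 * (k + 1) + 1) := by
        have := (ih a b).2
        change b * altL a b (2 * k + 1) * b = b * altL a b (2 * (k + 1))
        rw [mul_assoc, this]
      change a * altL b a (2 * (k + 1)) * b = a * altL b a (2 * (k + 1) + 1)
      rw [mul_assoc, h2]
  induction k generalizing a b with
  | zero => simp [altL, altR]
  | succ k ih =>
    have h1 : altR a b (2 * (k + 1)) = altL a b (2 * (k + 1)) := by
      change altR b a (2 * k + 1) * b = _
      rw [(ih a b).2, (hL k a b).2]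
    refine ⟨h1, ?_⟩
    change altR a b (2 * (k + 1)) * a = _
    rw [h1, (hL (k + 1) a b).1]

theorem altR_even (a b : A) (k : ℕ) : altR a b (2 * k) = altL a b (2 * k) :=
  (altR_aux a b k).1

theorem altR_odd (a b : A) (k : ℕ) : altR b a (2 * k + 1) = altL a b (2 * k + 1) :=
  (altR_aux a b k).2

end Words

section BMW

variable {F : Type*} [Field F]

/-- The symbols `X_i`, `X_i⁻¹` (written `Y i`) and `E_i`, `i = 0, 1`. -/
inductive BMWGen : Type
  | X (i : Fin 2)
  | Y (i : Fin 2)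
  | E (i : Fin 2)

/-- The letters in the free algebra. -/
abbrev fX (F : Type*) [Field F] (i : Fin 2) : FreeAlgebra F BMWGen :=
  FreeAlgebra.ι F (BMWGen.X i)

abbrev fY (F : Type*) [Field F] (i : Fin 2) : FreeAlgebra F BMWGen :=
  FreeAlgebra.ι F (BMWGen.Y i)

abbrev fE (F : Type*) [Field F] (i : Fin 2) : FreeAlgebra F BMWGen :=
  FreeAlgebra.ι F (BMWGen.E i)

/-- The defining relations of the dihedral BMW algebra of type `I_2(2n+1)`, with
`τ = (l - l⁻¹) / m + 1`. In a relation with one index `i`, the other index is `1 - i`. -/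
inductive BMWRel (n : ℕ) (m l : F) : FreeAlgebra F BMWGen → FreeAlgebra F BMWGen → Prop
  | mul_inv (i : Fin 2) : BMWRel n m l (fX F i * fY F i) 1
  | inv_mul (i : Fin 2) : BMWRel n m l (fY F i * fX F i) 1
  | braid : BMWRel n m l
      (altL (fX F 0) (fX F 1) (2 * n + 1)) (altL (fX F 1) (fX F 0) (2 * n + 1))
  | skein (i : Fin 2) : BMWRel n m l (fX F i - fY F i) (m • (fE F i - 1))
  | X_mul_E (i : Fin 2) : BMWRel n m l (fX F i * fE F i) (l • fE F i)
  | E_mul_X (i : Fin 2) : BMWRel n m l (fE F i * fX F i) (l • fE F i)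
  | E_mul_E (i : Fin 2) : BMWRel n m l (fE F i * fE F i) (((l - l⁻¹) / m + 1) • fE F i)
  | E_X_E (i : Fin 2) (k : ℕ) (h1 : 1 ≤ k) (h2 : k ≤ n) : BMWRel n m l
      (fE F i * altL (fX F (1 - i)) (fX F i) (2 * k - 1) * fE F i) (l⁻¹ • fE F i)
  | E_Y_E (i : Fin 2) (k : ℕ) (h1 : 1 ≤ k) (h2 : k ≤ n) : BMWRel n m l
      (fE F i * altL (fY F (1 - i)) (fY F i) (2 * k - 1) * fE F i) (l • fE F i)
  | X_E : BMWRel n m l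
      (altL (fX F 0) (fX F 1) (2 * n) * fE F 0) (fE F 1 * altL (fX F 0) (fX F 1) (2 * n))
  | E_X : BMWRel n m l
      (fE F 0 * altL (fX F 1) (fX F 0) (2 * n)) (altL (fX F 1) (fX F 0) (2 * n) * fE F 1)

/-- The dihedral BMW algebra `B_{I_2(2n+1)}(m, l)` over `F`. -/
def BMW (n : ℕ) (m l : F) : Type _ := RingQuot (BMWRel n m l)

noncomputable instance (n : ℕ) (m l : F) : Ring (BMW n m l) :=
  inferInstanceAs (Ring (RingQuot (BMWRel n m l)))

noncomputable instance (n : ℕ) (m l : F) : Algebra F (BMW n m l) :=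
  inferInstanceAs (Algebra F (RingQuot (BMWRel n m l)))

/-- The quotient map from the free algebra. -/
noncomputable def BMW.mk (n : ℕ) (m l : F) : FreeAlgebra F BMWGen →ₐ[F] BMW n m l :=
  RingQuot.mkAlgHom F (BMWRel n m l)

theorem BMW.mk_rel {n : ℕ} {m l : F} {x y : FreeAlgebra F BMWGen} (h : BMWRel n m l x y) :
    BMW.mk n m l x = BMW.mk n m l y :=
  RingQuot.mkAlgHom_rel F h

/-- The universal property of the presentation. -/
noncomputable def BMW.lift (n : ℕ) (m l : F) {A : Type*} [Semiring A] [Algebra F A]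
    (f : BMWGen → A)
    (hf : ∀ x y, BMWRel n m l x y → FreeAlgebra.lift F f x = FreeAlgebra.lift F f y) :
    BMW n m l →ₐ[F] A :=
  RingQuot.liftAlgHom F ⟨FreeAlgebra.lift F f, hf⟩

theorem BMW.lift_mk (n : ℕ) (m l : F) {A : Type*} [Semiring A] [Algebra F A]
    (f : BMWGen → A)
    (hf : ∀ x y, BMWRel n m l x y → FreeAlgebra.lift F f x = FreeAlgebra.lift F f y)
    (x : FreeAlgebra F BMWGen) :
    BMW.lift n m l f hf (BMW.mk n m l x) = FreeAlgebra.lift F f x :=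
  RingQuot.liftAlgHom_mkAlgHom_apply F _ _ x

/-- The canonical generators of `B_{I_2(2n+1)}(m, l)`, and the inverses of the `X_i`. -/
noncomputable def BMW.gen (n : ℕ) (m l : F) (g : BMWGen) : BMW n m l :=
  BMW.mk n m l (FreeAlgebra.ι F g)

noncomputable abbrev BMW.X (n : ℕ) (m l : F) (i : Fin 2) : BMW n m l := BMW.gen n m l (.X i)

noncomputable abbrev BMW.E (n : ℕ) (m l : F) (i : Fin 2) : BMW n m l := BMW.gen n m l (.E i)

/-- The homomorphism `B → Bᵐᵒᵖ` fixing every letter `X_i`, `X_i⁻¹`, `E_i`. -/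
noncomputable def BMW.revHom (n : ℕ) (m l : F) : BMW n m l →ₐ[F] (BMW n m l)ᵐᵒᵖ :=
  BMW.lift n m l (fun g => MulOpposite.op (BMW.gen n m l g)) (by
      have key : ∀ {x y}, BMWRel n m l x y → BMW.mk n m l x = BMW.mk n m l y := BMW.mk_rel
      rintro x y h
      apply MulOpposite.unop_injective
      cases h with
      | mul_inv i => simpa [BMW.gen] using key (.inv_mul i)
      | inv_mul i => simpa [BMW.gen] using key (.mul_inv i)
      | braid => simpa [BMW.gen, map_altL, altL_op, altR_odd] using key .braid
      | skein i => simpa [BMW.gen] using key (.skein i)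
      | X_mul_E i => simpa [BMW.gen] using key (.E_mul_X i)
      | E_mul_X i => simpa [BMW.gen] using key (.X_mul_E i)
      | E_mul_E i => simpa [BMW.gen] using key (.E_mul_E i)
      | E_X_E i k h1 h2 =>
        have hk := key (.E_X_E (n := n) (m := m) (l := l) i k h1 h2)
        obtain ⟨k, rfl⟩ := Nat.exists_eq_add_of_le' h1
        rw [show 2 * (k + 1) - 1 = 2 * k + 1 by omega] at hk ⊢
        simpa [BMW.gen, map_altL, altL_op, altR_odd, mul_assoc] using hk
      | E_Y_E i k h1 h2 =>
        have hk := key (.E_Y_E (n := n) (m := m) (l := l) i k h1 h2)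
        obtain ⟨k, rfl⟩ := Nat.exists_eq_add_of_le' h1
        rw [show 2 * (k + 1) - 1 = 2 * k + 1 by omega] at hk ⊢
        simpa [BMW.gen, map_altL, altL_op, altR_odd, mul_assoc] using hk
      | X_E => simpa [BMW.gen, map_altL, altL_op, altR_even] using key .E_X
      | E_X => simpa [BMW.gen, map_altL, altL_op, altR_even] using key .X_E)

/-- Word reversal on `B_{I_2(2n+1)}(m, l)`: the `F`-linear anti-endomorphism that reverses
every word in the letters `X_i`, `X_i⁻¹`, `E_i`. -/
noncomputable def BMW.rev (n : ℕ) (m l : F) : BMW n m l →ₗ[F] BMW n m l :=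
  (MulOpposite.opLinearEquiv F).symm.toLinearMap ∘ₗ (BMW.revHom n m l).toLinearMap

/-- The defining relations of the Hecke algebra of type `I_2(2n+1)` with parameter `v`. -/
inductive HeckeRel (n : ℕ) (v : F) : FreeAlgebra F (Fin 2) → FreeAlgebra F (Fin 2) → Prop
  | braid : HeckeRel n v
      (altL (FreeAlgebra.ι F 0) (FreeAlgebra.ι F 1) (2 * n + 1))
      (altL (FreeAlgebra.ι F 1) (FreeAlgebra.ι F 0) (2 * n + 1))
  | quadratic (i : Fin 2) : HeckeRel n v
      ((FreeAlgebra.ι F i + algebraMap F _ v) * (FreeAlgebra.ι F i - algebraMap F _ v⁻¹)) 0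

/-- The Hecke algebra `H_{I_2(2n+1)}(v)` over `F`. -/
def Hecke (n : ℕ) (v : F) : Type _ := RingQuot (HeckeRel n v)

noncomputable instance (n : ℕ) (v : F) : Ring (Hecke n v) :=
  inferInstanceAs (Ring (RingQuot (HeckeRel n v)))

noncomputable instance (n : ℕ) (v : F) : Algebra F (Hecke n v) :=
  inferInstanceAs (Algebra F (RingQuot (HeckeRel n v)))

/-- The quotient map from the free algebra. -/
noncomputable def Hecke.mk (n : ℕ) (v : F) : FreeAlgebra F (Fin 2) →ₐ[F] Hecke n v :=
  RingQuot.mkAlgHom F (HeckeRel n v)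

theorem Hecke.mk_rel {n : ℕ} {v : F} {x y : FreeAlgebra F (Fin 2)} (h : HeckeRel n v x y) :
    Hecke.mk n v x = Hecke.mk n v y :=
  RingQuot.mkAlgHom_rel F h

/-- The universal property of the presentation. -/
noncomputable def Hecke.lift (n : ℕ) (v : F) {A : Type*} [Semiring A] [Algebra F A]
    (f : (Fin 2) → A)
    (hf : ∀ x y, HeckeRel n v x y → FreeAlgebra.lift F f x = FreeAlgebra.lift F f y) :
    Hecke n v →ₐ[F] A :=
  RingQuot.liftAlgHom F ⟨FreeAlgebra.lift F f, hf⟩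

theorem Hecke.lift_mk (n : ℕ) (v : F) {A : Type*} [Semiring A] [Algebra F A]
    (f : (Fin 2) → A)
    (hf : ∀ x y, HeckeRel n v x y → FreeAlgebra.lift F f x = FreeAlgebra.lift F f y)
    (x : FreeAlgebra F (Fin 2)) :
    Hecke.lift n v f hf (Hecke.mk n v x) = FreeAlgebra.lift F f x :=
  RingQuot.liftAlgHom_mkAlgHom_apply F _ _ x

/-- The canonical generators `x_0`, `x_1` of `H_{I_2(2n+1)}(v)`. -/
noncomputable def Hecke.x (n : ℕ) (v : F) (i : Fin 2) : Hecke n v :=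
  Hecke.mk n v (FreeAlgebra.ι F i)

theorem Hecke.x_quadratic (n : ℕ) (v : F) (i : Fin 2) :
    (Hecke.x n v i + algebraMap F _ v) * (Hecke.x n v i - algebraMap F _ v⁻¹) = 0 := by
  have h := Hecke.mk_rel (HeckeRel.quadratic (n := n) (v := v) i)
  simpa only [Hecke.x, map_mul, map_add, map_sub, map_zero, AlgHom.commutes] using h

theorem Hecke.x_braid (n : ℕ) (v : F) :
    altL (Hecke.x n v 0) (Hecke.x n v 1) (2 * n + 1) =
      altL (Hecke.x n v 1) (Hecke.x n v 0) (2 * n + 1) := by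
  have h := Hecke.mk_rel (HeckeRel.braid (n := n) (v := v))
  simpa only [Hecke.x, map_altL] using h

/-- The homomorphism `H → Hᵐᵒᵖ` fixing `x_0` and `x_1`. -/
noncomputable def Hecke.revHom (n : ℕ) (v : F) : Hecke n v →ₐ[F] (Hecke n v)ᵐᵒᵖ :=
  Hecke.lift n v (fun i => MulOpposite.op (Hecke.x n v i)) (by
      rintro x y h
      apply MulOpposite.unop_injective
      cases h with
      | braid => simpa [map_altL, altL_op, altR_odd] using Hecke.x_braid n v
      | quadratic i =>
        have h := Hecke.x_quadratic n v i
        have hc : (Hecke.x n v i - algebraMap F _ v⁻¹) * (Hecke.x n v i + algebraMap F _ v)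
            = (Hecke.x n v i + algebraMap F _ v) * (Hecke.x n v i - algebraMap F _ v⁻¹) := by
          have c1 := Algebra.commutes v (Hecke.x n v i)
          have c2 := Algebra.commutes v⁻¹ (Hecke.x n v i)
          have c3 := Algebra.commutes v (algebraMap F (Hecke n v) v⁻¹)
          simp only [mul_add, add_mul, mul_sub, sub_mul, c1, c2, c3]
          abel
        rw [← hc] at h
        simpa only [map_mul, map_add, map_sub, map_zero, AlgHom.commutes,
          FreeAlgebra.lift_ι_apply, MulOpposite.unop_mul, MulOpposite.unop_add,
          MulOpposite.unop_sub, MulOpposite.unop_op, MulOpposite.unop_zero,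
          MulOpposite.algebraMap_apply] using h)

/-- Word reversal on `H_{I_2(2n+1)}(v)`: the `F`-linear anti-endomorphism that reverses every
word in `x_0`, `x_1`. -/
noncomputable def Hecke.rev (n : ℕ) (v : F) : Hecke n v →ₗ[F] Hecke n v :=
  (MulOpposite.opLinearEquiv F).symm.toLinearMap ∘ₗ (Hecke.revHom n v).toLinearMap

/-- The images `x_i`, `x_i⁻¹ = x_i + (v - v⁻¹)` and `0` of `X_i`, `X_i⁻¹` and `E_i`. -/
noncomputable def toHeckeGen (n : ℕ) (v : F) : BMWGen → Hecke n v
  | .X i => Hecke.x n v i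
  | .Y i => Hecke.x n v i + algebraMap F _ (v - v⁻¹)
  | .E _ => 0

/-- The quotient map `π : B_{I_2(2n+1)}(v - v⁻¹, l) → H_{I_2(2n+1)}(v)` with `X_i ↦ x_i` and
`E_i ↦ 0`. -/
noncomputable def toHecke (n : ℕ) (v l : F) (hv : v ≠ 0) :
    BMW n (v - v⁻¹) l →ₐ[F] Hecke n v :=
  BMW.lift n (v - v⁻¹) l (toHeckeGen n v) (by
      have hq : ∀ i, Hecke.x n v i * (Hecke.x n v i + algebraMap F _ (v - v⁻¹)) = 1 := by
        intro i
        have h := Hecke.x_quadratic n v i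
        have c1 := Algebra.commutes v (Hecke.x n v i)
        have c3 : algebraMap F (Hecke n v) v * algebraMap F (Hecke n v) v⁻¹ = 1 := by
          rw [← map_mul, mul_inv_cancel₀ hv, map_one]
        rw [← sub_eq_zero, ← h]
        simp only [map_sub, mul_add, add_mul, mul_sub, c1, c3]
        abel
      have hq' : ∀ i, (Hecke.x n v i + algebraMap F _ (v - v⁻¹)) * Hecke.x n v i = 1 := by
        intro i
        rw [← hq i, add_mul, mul_add, Algebra.commutes]
      rintro x y h
      cases h with
      | mul_inv i => simpa [toHeckeGen] using hq i
      | inv_mul i => simpa [toHeckeGen] using hq' i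
      | braid => simpa [map_altL, toHeckeGen] using Hecke.x_braid n v
      | skein i => simp [toHeckeGen, Algebra.smul_def]
      | _ => simp [toHeckeGen])

end BMW

section Cells

variable {F : Type*} [Field F] {Λ : Type u}

/-- The index sets of the cells: those of the given cells, and `{0, 1, …, 2n}` for the extra
bottom cell. The poset of the cells is `WithBot Λ`, with the extra cell `⊥` below all others. -/
def cellIndex (n : ℕ) (M : Λ → Type) : WithBot Λ → Type :=
  WithBot.recBotCoe (Fin (2 * n + 1)) M

instance cellIndexFintype (n : ℕ) (M : Λ → Type) [h : ∀ μ, Fintype (M μ)] :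
    ∀ μ : WithBot Λ, Fintype (cellIndex n M μ) :=
  WithBot.recBotCoe (inferInstanceAs (Fintype (Fin (2 * n + 1)))) h

/-- The elements attached to one cell lying over a Hecke cell, from a choice `D S T` of lifts
(for `S ≤ T`): `C_{S,T} = D_{S,T}` for `S < T`, `C_{S,T} = rev C_{T,S}` for `T < S`, and
`C_{S,S} = (D_{S,S} + rev D_{S,S}) / 2`. -/
noncomputable def liftCell {M : Type*} [LinearOrder M] (n : ℕ) (m l : F)
    (D : M → M → BMW n m l) (S T : M) : BMW n m l :=
  if S < T then D S T
  else if T < S then BMW.rev n m l (D T S)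
  else (2⁻¹ : F) • (D S S + BMW.rev n m l (D S S))

/-- The full family: the lifted elements in the cells from `Λ`, and
`C_{i,j} = [⋯X_0 X_1]_i E_0 [X_1 X_0 ⋯]_j`, `0 ≤ i, j ≤ 2n`, in the extra cell `⊥`. -/
noncomputable def cellElement (n : ℕ) (m l : F) (M : Λ → Type) [∀ μ, LinearOrder (M μ)]
    (D : ∀ μ, M μ → M μ → BMW n m l) :
    ∀ μ : WithBot Λ, cellIndex n M μ → cellIndex n M μ → BMW n m l :=
  WithBot.recBotCoe
    (fun i j : Fin (2 * n + 1) =>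
      altR (BMW.X n m l 0) (BMW.X n m l 1) i * BMW.E n m l 0 *
        altL (BMW.X n m l 1) (BMW.X n m l 0) j)
    (fun μ => liftCell (M := M μ) n m l (D μ))

end Cells

end DihedralBMW

/-
The words `[⋯ X_0 X_1]_i E_0 [X_1 X_0 ⋯]_j` span a two-sided ideal of the BMW algebra, the kernel
of the quotient map onto the Hecke algebra. The algebra acts on their left factors as on the left
ideal generated by `E_0`. This action, written down on the standard basis, is the Lawrence–Krammer
representation: `E_0` becomes a rank one operator given by the first row of a bilinear form, and the
words are linearly independent as soon as the Gram matrix of the form is invertible. Up to a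
denominator the Gram matrix specialises at `v = 1` to a scalar matrix, so its determinant is
nonzero. Hence the words form a bottom cell, and any lift of a cell basis of the Hecke algebra
completes it to a cell basis.

For the Hecke algebra, put `a = x_0 + v`, `b = x_1 + v` and `δ = v + v⁻¹`, so that `a ^ 2 = δ a` and
`b ^ 2 = δ b`. The element `t = a b + b a - δ (a + b) + δ ^ 2` is central, and the braid relation
says that `Q(t) (a - b) = 0` for a polynomial `Q` of degree `n` with the roots
`2 + ζ ^ j + ζ ^ (-j)`. The partial products of the factors `t - c_j` of `Q(t)` cut out a chain of
ideals with `2 × 2` cells as quotients, between the one-dimensional cells of `1` and of `Q(t) a`.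
-/

namespace DihedralBMW

section AlternatingWords

variable {A : Type*} [Monoid A]

theorem altL_succ (a b : A) (N : ℕ) :
    altL a b (N + 1) = altL a b N * (if Even N then a else b) := by
  induction N generalizing a b with
  | zero => simp [altL]
  | succ N ih =>
    change a * altL b a (N + 1) = a * altL b a N * _
    rw [ih, ← mul_assoc]
    by_cases h : Even N <;> simp [h, Nat.even_add_one]

theorem altL_succ_of_odd (x : Fin 2 → A) {N : ℕ} {i : Fin 2} (h : (N + i) % 2 = 1) :
    altL (x 1) (x 0) (N + 1) = altL (x 1) (x 0) N * x i := by
  rw [altL_succ]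
  fin_cases i
  · rw [if_neg (by rw [Nat.even_iff]; simp_all)]; rfl
  · rw [if_pos (by rw [Nat.even_iff]; simp at h; omega)]; rfl

theorem altR_succ_of_odd (x : Fin 2 → A) {N : ℕ} {i : Fin 2} (h : (N + i) % 2 = 1) :
    altR (x 0) (x 1) (N + 1) = x i * altR (x 0) (x 1) N := by
  apply MulOpposite.op_injective
  rw [MulOpposite.op_mul, ← altL_op, ← altL_op]
  exact altL_succ_of_odd (fun j => MulOpposite.op (x j)) h

theorem altL_succ_of_even (x : Fin 2 → A) {N : ℕ} {i : Fin 2} (h : (N + i) % 2 = 0) :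
    altL (x 0) (x 1) (N + 1) = altL (x 0) (x 1) N * x i := by
  rw [altL_succ]
  fin_cases i
  · rw [if_pos (by rw [Nat.even_iff]; simpa using h)]; rfl
  · rw [if_neg (by rw [Nat.even_iff]; simp at h; omega)]; rfl

theorem altR_succ_of_even (x : Fin 2 → A) {N : ℕ} {i : Fin 2} (h : (N + i) % 2 = 0) :
    altR (x 1) (x 0) (N + 1) = x i * altR (x 1) (x 0) N := by
  apply MulOpposite.op_injective
  rw [MulOpposite.op_mul, ← altL_op, ← altL_op]
  exact altL_succ_of_even (fun j => MulOpposite.op (x j)) h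

theorem map_altR {B G : Type*} [Monoid B] [FunLike G A B] [MonoidHomClass G A B] (f : G)
    (a b : A) (N : ℕ) : f (altR a b N) = altR (f a) (f b) N := by
  induction N generalizing a b with
  | zero => simp [altR]
  | succ N ih => simp [altR, ih]

theorem altR_mul_altL_eq_one {x x' y y' : A} (hx : x * x' = 1) (hy : y * y' = 1) (N : ℕ) :
    altR x y N * altL y' x' N = 1 := by
  induction N generalizing x x' y y' with
  | zero => exact one_mul 1
  | succ N ih =>
    change altR y x N * y * (y' * altL x' y' N) = 1
    rw [mul_assoc, ← mul_assoc y, hy, one_mul, ih hy hx]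

theorem exists_add_mod_two_eq_one (k : ℕ) : ∃ i : Fin 2, (k + i) % 2 = 1 := by
  rcases k.mod_two_eq_zero_or_one with h | h
  · exact ⟨1, by simp; omega⟩
  · exact ⟨0, by simpa using h⟩

theorem exists_add_mod_two_eq_zero (k : ℕ) : ∃ i : Fin 2, (k + i) % 2 = 0 := by
  rcases k.mod_two_eq_zero_or_one with h | h
  · exact ⟨0, by simpa using h⟩
  · exact ⟨1, by simp; omega⟩

end AlternatingWords

section StdVec

variable {F : Type*} [Semiring F] {N : ℕ} {W : Type*} [AddCommMonoid W] [Module F W]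

variable (F N) in
/-- The standard basis of `F ^ N`, indexed by natural numbers so that index arithmetic needs no
bound proofs; the vectors with `k ≥ N` are `0`. -/
def stdVec (k : ℕ) : Fin N → F := fun i => if (i : ℕ) = k then 1 else 0

theorem stdVec_coe (i : Fin N) : stdVec F N i = Pi.single i 1 := by
  ext j
  simp [stdVec, Pi.single_apply, Fin.ext_iff]

theorem stdVec_ext {f g : (Fin N → F) →ₗ[F] W}
    (h : ∀ k < N, f (stdVec F N k) = g (stdVec F N k)) : f = g :=
  LinearMap.pi_ext' fun i => LinearMap.ext_ring (by simpa [stdVec_coe] using h i i.2)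

theorem linearCombination_stdVec {F : Type*} [CommSemiring F] [Module F W] (g : ℕ → W) {k : ℕ}
    (hk : k < N) :
    Fintype.linearCombination F (fun i : Fin N => g i) (stdVec F N k) = g k := by
  lift k to Fin N using hk
  rw [stdVec_coe, Fintype.linearCombination_apply_single, one_smul]

end StdVec

section Ladder

variable {F : Type*} [Field F] {n : ℕ} {m l : F}

/-- The end of the ladder `0, 1, …, 2n` fixed by the reflection `i`; this reflection pairs every
other index `a` of parity opposite to `i` with `a + 1`. -/
def ladderEnd (n : ℕ) (i : Fin 2) : ℕ := ![0, 2 * n] i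

theorem ladderEnd_le (i : Fin 2) : ladderEnd n i ≤ 2 * n := by
  fin_cases i <;> simp [ladderEnd]

theorem ladder_cases (i : Fin 2) {P : ℕ → Prop} (hend : P (ladderEnd n i))
    (hlow : ∀ a < 2 * n, (a + i) % 2 = 1 → P a)
    (hhigh : ∀ a < 2 * n, (a + i) % 2 = 1 → P (a + 1)) {k : ℕ} (hk : k ≤ 2 * n) : P k := by
  by_cases he : k = ladderEnd n i
  · exact he ▸ hend
  rcases (k + i).mod_two_eq_zero_or_one with h | h
  · obtain ⟨a, rfl⟩ : ∃ a, k = a + 1 := Nat.exists_eq_add_one_of_ne_zero <| by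
      fin_cases i <;> simp_all [ladderEnd]; omega
    exact hhigh a (by omega) (by omega)
  · refine hlow k (lt_of_le_of_ne hk ?_) h
    fin_cases i <;> simp_all [ladderEnd]; omega

/-- Two operators `Y 0`, `Y 1` act on a sequence `w 0, …, w (2n)` as the inverses of the two braid
generators act on the basis of the Lawrence–Krammer representation. The dual representation carries
the same structure with other parameters. -/
structure IsLadder {W : Type*} [AddCommGroup W] [Module F W] (n : ℕ) (m l : F)
    (Y : Fin 2 → Module.End F W) (w : ℕ → W) : Prop where
  apply_zero : Y 0 (w 0) = l • w 0
  apply_high : ∀ {i : Fin 2} {a : ℕ}, a < 2 * n → (a + i) % 2 = 1 → Y i (w (a + 1)) = w a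
  apply_low : ∀ {i : Fin 2} {a : ℕ}, a < 2 * n → (a + i) % 2 = 1 →
    Y i (w a) = w (a + 1) - (m * ![l, 1] i) • w (ladderEnd n i) + m • w a

namespace IsLadder

variable {W : Type*} [AddCommGroup W] [Module F W] {Y : Fin 2 → Module.End F W} {w : ℕ → W}

theorem apply_one_sum_odd (h : IsLadder n m l Y w) {p : ℕ} (hp : p < n) :
    Y 1 (∑ q ∈ Finset.range p, (w (2 * q + 1) - w (2 * (n - 1 - q) + 1))) + w (2 * p) - w (2 * n) =
      ∑ q ∈ Finset.range (p + 1), (w (2 * q) - w (2 * (n - q))) := by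
  have image : ∀ q ∈ Finset.range p, Y 1 (w (2 * q + 1) - w (2 * (n - 1 - q) + 1)) =
      w (2 * q) - w (2 * (n - (q + 1))) := fun q hq => by
    have hq := Finset.mem_range.1 hq
    rw [map_sub, h.apply_high (by omega) (by simp), h.apply_high (by omega) (by simp),
      Nat.sub_sub, add_comm 1 q]
  rw [map_sum, Finset.sum_congr rfl image, Finset.sum_sub_distrib, Finset.sum_sub_distrib,
    Finset.sum_range_succ, Finset.sum_range_succ' (fun q => w (2 * (n - q))), Nat.sub_zero]
  abel

theorem apply_zero_sum_even (h : IsLadder n m l Y w) {p : ℕ} (hp : p < n) :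
    Y 0 (∑ q ∈ Finset.range (p + 1), (w (2 * q) - w (2 * (n - q)))) + w (2 * p + 1) - l • w 0 =
      ∑ q ∈ Finset.range (p + 1), (w (2 * q + 1) - w (2 * (n - 1 - q) + 1)) := by
  have image_low : ∀ q ∈ Finset.range p, Y 0 (w (2 * (q + 1))) = w (2 * q + 1) := fun q hq => by
    have hq := Finset.mem_range.1 hq
    exact h.apply_high (a := 2 * q + 1) (by omega) (by simp)
  have image_high : ∀ q ∈ Finset.range (p + 1), Y 0 (w (2 * (n - q))) = w (2 * (n - 1 - q) + 1) :=
    fun q hq => by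
      have hq := Finset.mem_range.1 hq
      rw [show 2 * (n - q) = 2 * (n - 1 - q) + 1 + 1 by omega]
      exact h.apply_high (by omega) (by simp)
  simp only [map_sum, map_sub, Finset.sum_sub_distrib]
  rw [Finset.sum_congr rfl image_high, Finset.sum_range_succ', Finset.sum_congr rfl image_low,
    mul_zero, h.apply_zero, Finset.sum_range_succ (fun q => w (2 * q + 1))]
  abel

theorem altR_apply_even (h : IsLadder n m l Y w) {p : ℕ} (hp : p ≤ n) :
    altR (Y 0) (Y 1) (2 * p) (w 0) = w (2 * p) +
      m • ∑ q ∈ Finset.range p, (w (2 * q + 1) - w (2 * (n - 1 - q) + 1)) := by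
  induction p with
  | zero => simp [altR]
  | succ p ih =>
    have odd_step : altR (Y 0) (Y 1) (2 * p + 1) (w 0) = w (2 * p + 1) +
        m • ∑ q ∈ Finset.range (p + 1), (w (2 * q) - w (2 * (n - q))) := by
      rw [altR_succ_of_odd Y (i := 1) (by simp), Module.End.mul_apply, ih (by omega), map_add,
        map_smul, h.apply_low (by omega) (by simp), ← h.apply_one_sum_odd hp]
      simp only [ladderEnd, Matrix.cons_val_one, Matrix.cons_val_fin_one]
      module
    rw [mul_add_one, altR_succ_of_odd Y (i := 0) (by simp), Module.End.mul_apply, odd_step,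
      map_add, map_smul, h.apply_low (by omega) (by simp), ← h.apply_zero_sum_even hp]
    simp only [ladderEnd, Matrix.cons_val_zero]
    module

theorem altR_apply_last (h : IsLadder n m l Y w) :
    altR (Y 0) (Y 1) (2 * n) (w 0) = w (2 * n) := by
  rw [h.altR_apply_even le_rfl, Finset.sum_sub_distrib,
    Finset.sum_range_reflect (fun q => w (2 * q + 1)), sub_self, smul_zero, add_zero]

end IsLadder

end Ladder

section LawrenceKrammerForm

variable {F : Type*} [Field F] {n : ℕ} {m l : F}

/-- The entry `(j, k)` of the Gram matrix of the Lawrence–Krammer cell, that is, the scalar in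
`E_0 [X_1⁻¹ X_0⁻¹ ⋯]_j [⋯ X_0 X_1]_k E_0 = lkCoeff m l j k • E_0`. -/
def lkCoeff (m l : F) (j k : ℕ) : F :=
  if k = j then (l - l⁻¹) / m + 1 else if k % 2 = j % 2 then 1 else if k < j then l else l⁻¹

theorem lkCoeff_self (j : ℕ) : lkCoeff m l j j = (l - l⁻¹) / m + 1 := if_pos rfl

theorem lkCoeff_of_mod_eq {j k : ℕ} (h : k ≠ j) (h' : k % 2 = j % 2) : lkCoeff m l j k = 1 := by
  rw [lkCoeff, if_neg h, if_pos h']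

theorem lkCoeff_of_lt {j k : ℕ} (h : k < j) (h' : k % 2 ≠ j % 2) : lkCoeff m l j k = l := by
  rw [lkCoeff, if_neg h.ne, if_neg h', if_pos h]

theorem lkCoeff_of_gt {j k : ℕ} (h : j < k) (h' : k % 2 ≠ j % 2) : lkCoeff m l j k = l⁻¹ := by
  rw [lkCoeff, if_neg h.ne', if_neg h', if_neg h.not_gt]

theorem lkCoeff_succ_succ (j k : ℕ) : lkCoeff m l (j + 1) (k + 1) = lkCoeff m l j k := by
  simp only [lkCoeff, add_left_inj, Nat.succ_lt_succ_iff,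
    show ((k + 1) % 2 = (j + 1) % 2) = (k % 2 = j % 2) from propext (by omega)]

theorem mul_lkCoeff_self (hm : m ≠ 0) (j : ℕ) : m * lkCoeff m l j j = l - l⁻¹ + m := by
  rw [lkCoeff_self, mul_add, mul_div_cancel₀ _ hm, mul_one]

section Ends

variable {i : Fin 2} {a b : ℕ}

theorem lkCoeff_end_low (ha : a < 2 * n) (h : (a + i) % 2 = 1) :
    lkCoeff m l (ladderEnd n i) a = ![l⁻¹, 1] i := by
  fin_cases i
  · exact lkCoeff_of_gt (Nat.pos_of_ne_zero (by rintro rfl; simp at h)) (by simp_all [ladderEnd])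
  · exact lkCoeff_of_mod_eq ha.ne (by simp [ladderEnd] at h ⊢; omega)

theorem lkCoeff_low_end (ha : a < 2 * n) (h : (a + i) % 2 = 1) :
    lkCoeff m l a (ladderEnd n i) = ![l, 1] i := by
  fin_cases i
  · exact lkCoeff_of_lt (Nat.pos_of_ne_zero (by rintro rfl; simp at h)) (by simp_all [ladderEnd])
  · exact lkCoeff_of_mod_eq ha.ne' (by simp [ladderEnd] at h ⊢; omega)

theorem lkCoeff_end_high (ha : a < 2 * n) (h : (a + i) % 2 = 1) :
    lkCoeff m l (ladderEnd n i) (a + 1) = ![1, l] i := by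
  fin_cases i
  · exact lkCoeff_of_mod_eq a.succ_ne_zero (by simp [ladderEnd] at h ⊢; omega)
  · exact lkCoeff_of_lt (by simp [ladderEnd] at h ⊢; omega) (by simp [ladderEnd] at h ⊢; omega)

theorem lkCoeff_high_end (ha : a < 2 * n) (h : (a + i) % 2 = 1) :
    lkCoeff m l (a + 1) (ladderEnd n i) = ![1, l⁻¹] i := by
  fin_cases i
  · exact lkCoeff_of_mod_eq a.succ_ne_zero.symm (by simp [ladderEnd] at h ⊢; omega)
  · exact lkCoeff_of_gt (by simp [ladderEnd] at h ⊢; omega) (by simp [ladderEnd] at h ⊢; omega)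

theorem mul_lkCoeff_end_low (hl : l ≠ 0) (ha : a < 2 * n) (h : (a + i) % 2 = 1) :
    l * lkCoeff m l (ladderEnd n i) a = lkCoeff m l (ladderEnd n i) (a + 1) := by
  rw [lkCoeff_end_low ha h, lkCoeff_end_high ha h]
  fin_cases i <;> simp [hl]

theorem inv_mul_lkCoeff_low_end (hl : l ≠ 0) (ha : a < 2 * n) (h : (a + i) % 2 = 1) :
    l⁻¹ * lkCoeff m l a (ladderEnd n i) = lkCoeff m l (a + 1) (ladderEnd n i) := by
  rw [lkCoeff_low_end ha h, lkCoeff_high_end ha h]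
  fin_cases i <;> simp [hl]

theorem lkCoeff_exchange (hm : m ≠ 0) (hl : l ≠ 0) (ha : a < 2 * n) (hb : b < 2 * n)
    (hai : (a + i) % 2 = 1) (hbi : (b + i) % 2 = 1) :
    lkCoeff m l a (b + 1) - m * lkCoeff m l (ladderEnd n i) b * lkCoeff m l a (ladderEnd n i) +
      m * lkCoeff m l a b = lkCoeff m l (a + 1) b := by
  have ends : lkCoeff m l (ladderEnd n i) b * lkCoeff m l a (ladderEnd n i) = 1 := by
    rw [lkCoeff_end_low hb hbi, lkCoeff_low_end ha hai]
    fin_cases i <;> simp [hl]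
  rw [mul_assoc, ends]
  rcases lt_trichotomy a b with h | rfl | h
  · rw [lkCoeff_of_gt (by omega) (by omega), lkCoeff_of_mod_eq h.ne' (by omega),
      lkCoeff_of_gt (by omega) (by omega)]
    ring
  · rw [lkCoeff_of_gt (by omega) (by omega), mul_lkCoeff_self hm,
      lkCoeff_of_lt (by omega) (by omega)]
    ring
  · rw [lkCoeff_of_lt (by omega) (by omega), lkCoeff_of_mod_eq h.ne (by omega),
      lkCoeff_of_lt (by omega) (by omega)]
    ring

end Ends

variable (F) in
/-- The basis vector `w_k` of the Lawrence–Krammer representation. -/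
abbrev lkVec (n k : ℕ) : Fin (2 * n + 1) → F := stdVec F (2 * n + 1) k

theorem lkVec_ext {W : Type*} [AddCommMonoid W] [Module F W]
    {f g : (Fin (2 * n + 1) → F) →ₗ[F] W} (i : Fin 2)
    (hend : f (lkVec F n (ladderEnd n i)) = g (lkVec F n (ladderEnd n i)))
    (hlow : ∀ a < 2 * n, (a + i) % 2 = 1 → f (lkVec F n a) = g (lkVec F n a))
    (hhigh : ∀ a < 2 * n, (a + i) % 2 = 1 → f (lkVec F n (a + 1)) = g (lkVec F n (a + 1))) :
    f = g :=
  stdVec_ext fun _ hk =>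
    ladder_cases i (P := fun k => f (lkVec F n k) = g (lkVec F n k)) hend hlow hhigh (by omega)

/-- The linear form whose coefficients are the row `j` of the Gram matrix. -/
noncomputable def lkForm (n : ℕ) (m l : F) (j : ℕ) : Module.Dual F (Fin (2 * n + 1) → F) :=
  Fintype.linearCombination F fun k : Fin (2 * n + 1) => lkCoeff m l j k

theorem lkForm_lkVec (j : ℕ) {k : ℕ} (hk : k ≤ 2 * n) :
    lkForm n m l j (lkVec F n k) = lkCoeff m l j k :=
  linearCombination_stdVec (lkCoeff m l j) (Nat.lt_succ_of_le hk)

end LawrenceKrammerForm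

section LawrenceKrammerOperators

variable {F : Type*} [Field F] {n : ℕ} {m l : F}

/-- The operator `E_i` of the Lawrence–Krammer representation. -/
noncomputable def lkE (n : ℕ) (m l : F) (i : Fin 2) : Module.End F (Fin (2 * n + 1) → F) :=
  (lkForm n m l (ladderEnd n i)).smulRight (lkVec F n (ladderEnd n i))

/-- The operator `X_i` of the Lawrence–Krammer representation. -/
noncomputable def lkX (n : ℕ) (m l : F) (i : Fin 2) : Module.End F (Fin (2 * n + 1) → F) :=
  Fintype.linearCombination F fun k : Fin (2 * n + 1) =>
    if (k : ℕ) = ladderEnd n i then l • lkVec F n k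
    else if (k + i : ℕ) % 2 = 1 then lkVec F n (k + 1)
    else lkVec F n (k - 1) - m • lkVec F n k +
      (m * l * lkCoeff m l (ladderEnd n i) (k - 1)) • lkVec F n (ladderEnd n i)

/-- The operator `X_i⁻¹` of the Lawrence–Krammer representation, as dictated by the skein
relation. -/
noncomputable def lkY (n : ℕ) (m l : F) (i : Fin 2) : Module.End F (Fin (2 * n + 1) → F) :=
  lkX n m l i - m • (lkE n m l i - 1)

theorem lkE_apply (i : Fin 2) (x : Fin (2 * n + 1) → F) :
    lkE n m l i x = lkForm n m l (ladderEnd n i) x • lkVec F n (ladderEnd n i) := rfl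

theorem lkE_lkVec (i : Fin 2) {k : ℕ} (hk : k ≤ 2 * n) :
    lkE n m l i (lkVec F n k) = lkCoeff m l (ladderEnd n i) k • lkVec F n (ladderEnd n i) := by
  rw [lkE_apply, lkForm_lkVec _ hk]

theorem lkY_apply (i : Fin 2) (x : Fin (2 * n + 1) → F) :
    lkY n m l i x = lkX n m l i x - m • lkE n m l i x + m • x := by
  simp only [lkY, LinearMap.sub_apply, LinearMap.smul_apply, Module.End.one_apply]
  module

section Ladder

variable {i : Fin 2} {a : ℕ}

theorem lkX_lkVec {k : ℕ} (hk : k ≤ 2 * n) : lkX n m l i (lkVec F n k) =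
    if k = ladderEnd n i then l • lkVec F n k
    else if (k + i) % 2 = 1 then lkVec F n (k + 1)
    else lkVec F n (k - 1) - m • lkVec F n k +
      (m * l * lkCoeff m l (ladderEnd n i) (k - 1)) • lkVec F n (ladderEnd n i) :=
  linearCombination_stdVec (fun k => if k = ladderEnd n i then l • lkVec F n k
    else if (k + i) % 2 = 1 then lkVec F n (k + 1)
    else lkVec F n (k - 1) - m • lkVec F n k +
      (m * l * lkCoeff m l (ladderEnd n i) (k - 1)) • lkVec F n (ladderEnd n i))
    (Nat.lt_succ_of_le hk)

theorem lkX_end (i : Fin 2) :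
    lkX n m l i (lkVec F n (ladderEnd n i)) = l • lkVec F n (ladderEnd n i) := by
  rw [lkX_lkVec (ladderEnd_le i), if_pos rfl]

theorem lkX_low (ha : a < 2 * n) (h : (a + i) % 2 = 1) :
    lkX n m l i (lkVec F n a) = lkVec F n (a + 1) := by
  have ne_end : a ≠ ladderEnd n i := by
    rintro rfl
    fin_cases i <;> simp [ladderEnd] at h ha
  rw [lkX_lkVec ha.le, if_neg ne_end, if_pos h]

theorem lkX_high (ha : a < 2 * n) (h : (a + i) % 2 = 1) :
    lkX n m l i (lkVec F n (a + 1)) = lkVec F n a - m • lkVec F n (a + 1) +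
      (m * l * lkCoeff m l (ladderEnd n i) a) • lkVec F n (ladderEnd n i) := by
  have ne_end : a + 1 ≠ ladderEnd n i := by
    fin_cases i <;> simp [ladderEnd] at h ⊢; omega
  rw [lkX_lkVec (show a + 1 ≤ 2 * n from ha), if_neg ne_end, if_neg (by omega), Nat.add_sub_cancel]

theorem lkY_end (hm : m ≠ 0) (i : Fin 2) :
    lkY n m l i (lkVec F n (ladderEnd n i)) = l⁻¹ • lkVec F n (ladderEnd n i) := by
  rw [lkY_apply, lkX_end, lkE_lkVec i (ladderEnd_le i), smul_smul, mul_lkCoeff_self hm]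
  module

theorem lkY_low (ha : a < 2 * n) (h : (a + i) % 2 = 1) :
    lkY n m l i (lkVec F n a) = lkVec F n (a + 1) -
      (m * lkCoeff m l (ladderEnd n i) a) • lkVec F n (ladderEnd n i) + m • lkVec F n a := by
  rw [lkY_apply, lkX_low ha h, lkE_lkVec i ha.le, smul_smul]

theorem lkY_high (hl : l ≠ 0) (ha : a < 2 * n) (h : (a + i) % 2 = 1) :
    lkY n m l i (lkVec F n (a + 1)) = lkVec F n a := by
  rw [lkY_apply, lkX_high ha h, lkE_lkVec i ha, ← mul_lkCoeff_end_low hl ha h]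
  module

end Ladder

section Inverse

theorem lkX_mul_lkY (hm : m ≠ 0) (hl : l ≠ 0) (i : Fin 2) : lkX n m l i * lkY n m l i = 1 := by
  refine lkVec_ext i ?_ (fun a ha h => ?_) (fun a ha h => ?_)
  · rw [Module.End.mul_apply, lkY_end hm, map_smul, lkX_end, smul_smul, inv_mul_cancel₀ hl,
      one_smul, Module.End.one_apply]
  · rw [Module.End.mul_apply, lkY_low ha h, map_add, map_sub, map_smul, map_smul, lkX_high ha h,
      lkX_low ha h, lkX_end, Module.End.one_apply]
    module
  · rw [Module.End.mul_apply, lkY_high hl ha h, lkX_low ha h, Module.End.one_apply]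

theorem lkY_mul_lkX (hm : m ≠ 0) (hl : l ≠ 0) (i : Fin 2) : lkY n m l i * lkX n m l i = 1 :=
  mul_eq_one_comm.1 (lkX_mul_lkY hm hl i)

theorem lkX_mul_lkE (i : Fin 2) : lkX n m l i * lkE n m l i = l • lkE n m l i := by
  refine LinearMap.ext fun x => ?_
  simp only [Module.End.mul_apply, LinearMap.smul_apply, lkE_apply, map_smul, lkX_end, smul_comm l]

variable {i : Fin 2} {a : ℕ}

theorem lkForm_end_comp_lkY (hm : m ≠ 0) (hl : l ≠ 0) (i : Fin 2) :
    lkForm n m l (ladderEnd n i) ∘ₗ lkY n m l i = l⁻¹ • lkForm n m l (ladderEnd n i) := by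
  refine lkVec_ext i ?_ (fun b hb h => ?_) (fun b hb h => ?_) <;>
    rw [LinearMap.comp_apply, LinearMap.smul_apply, smul_eq_mul]
  · rw [lkY_end hm, map_smul, smul_eq_mul]
  · rw [lkY_low hb h, map_add, map_sub, map_smul, map_smul, smul_eq_mul, smul_eq_mul,
      lkForm_lkVec _ hb, lkForm_lkVec _ (ladderEnd_le i), lkForm_lkVec _ hb.le, mul_right_comm,
      mul_lkCoeff_self hm, ← mul_lkCoeff_end_low hl hb h]
    ring
  · rw [lkY_high hl hb h, lkForm_lkVec _ hb, lkForm_lkVec _ hb.le, ← mul_lkCoeff_end_low hl hb h,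
      inv_mul_cancel_left₀ hl]

theorem lkForm_comp_lkY (hm : m ≠ 0) (hl : l ≠ 0) (ha : a < 2 * n) (h : (a + i) % 2 = 1) :
    lkForm n m l a ∘ₗ lkY n m l i = lkForm n m l (a + 1) := by
  refine lkVec_ext i ?_ (fun b hb hbi => ?_) (fun b hb hbi => ?_) <;> rw [LinearMap.comp_apply]
  · rw [lkY_end hm, map_smul, lkForm_lkVec _ (ladderEnd_le i), lkForm_lkVec _ (ladderEnd_le i),
      smul_eq_mul, inv_mul_lkCoeff_low_end hl ha h]
  · rw [lkY_low hb hbi, map_add, map_sub, map_smul, map_smul, lkForm_lkVec _ hb,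
      lkForm_lkVec _ (ladderEnd_le i), lkForm_lkVec _ hb.le, lkForm_lkVec _ hb.le, smul_eq_mul,
      smul_eq_mul, lkCoeff_exchange hm hl ha hb h hbi]
  · rw [lkY_high hl hb hbi, lkForm_lkVec _ hb.le, lkForm_lkVec _ hb, lkCoeff_succ_succ]

theorem lkForm_end_comp_lkX (hm : m ≠ 0) (hl : l ≠ 0) (i : Fin 2) :
    lkForm n m l (ladderEnd n i) ∘ₗ lkX n m l i = l • lkForm n m l (ladderEnd n i) := by
  have h : lkForm n m l (ladderEnd n i) = l • (lkForm n m l (ladderEnd n i) ∘ₗ lkY n m l i) := by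
    rw [lkForm_end_comp_lkY hm hl, smul_inv_smul₀ hl]
  nth_rewrite 1 [h]
  rw [LinearMap.smul_comp, LinearMap.comp_assoc, ← Module.End.mul_eq_comp, lkY_mul_lkX hm hl,
    Module.End.one_eq_id, LinearMap.comp_id]

theorem lkForm_succ_comp_lkX (hm : m ≠ 0) (hl : l ≠ 0) (ha : a < 2 * n) (h : (a + i) % 2 = 1) :
    lkForm n m l (a + 1) ∘ₗ lkX n m l i = lkForm n m l a := by
  rw [← lkForm_comp_lkY hm hl ha h, LinearMap.comp_assoc, ← Module.End.mul_eq_comp,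
    lkY_mul_lkX hm hl, Module.End.one_eq_id, LinearMap.comp_id]

theorem lkForm_comp_lkX (hm : m ≠ 0) (hl : l ≠ 0) (ha : a < 2 * n) (h : (a + i) % 2 = 1) :
    lkForm n m l a ∘ₗ lkX n m l i = lkForm n m l (a + 1) +
      (m * lkCoeff m l a (ladderEnd n i)) • lkForm n m l (ladderEnd n i) - m • lkForm n m l a := by
  refine LinearMap.ext fun x => ?_
  have hY := LinearMap.congr_fun (lkForm_comp_lkY hm hl ha h) x
  rw [LinearMap.comp_apply, lkY_apply, map_add, map_sub, map_smul, map_smul, lkE_apply, map_smul,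
    lkForm_lkVec _ (ladderEnd_le i)] at hY
  simp only [LinearMap.comp_apply, LinearMap.sub_apply, LinearMap.add_apply, LinearMap.smul_apply,
    ← hY, smul_eq_mul]
  ring

theorem lkE_mul_lkX (hm : m ≠ 0) (hl : l ≠ 0) (i : Fin 2) :
    lkE n m l i * lkX n m l i = l • lkE n m l i := by
  refine LinearMap.ext fun x => ?_
  rw [Module.End.mul_apply, lkE_apply, ← LinearMap.comp_apply, lkForm_end_comp_lkX hm hl,
    LinearMap.smul_apply, smul_assoc, LinearMap.smul_apply, lkE_apply]

end Inverse

end LawrenceKrammerOperators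

section LawrenceKrammerWords

variable {F : Type*} [Field F] {n : ℕ} {m l : F}

theorem altR_lkX_lkVec_zero {j : ℕ} (hj : j ≤ 2 * n) :
    altR (lkX n m l 0) (lkX n m l 1) j (lkVec F n 0) = lkVec F n j := by
  induction j with
  | zero => rfl
  | succ j ih =>
    obtain ⟨i, hi⟩ := exists_add_mod_two_eq_one j
    rw [altR_succ_of_odd (lkX n m l) hi, Module.End.mul_apply, ih (by omega), lkX_low hj hi]

theorem altR_lkY_lkVec_last (hl : l ≠ 0) {j : ℕ} (hj : j ≤ 2 * n) :
    altR (lkY n m l 1) (lkY n m l 0) j (lkVec F n (2 * n)) = lkVec F n (2 * n - j) := by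
  induction j with
  | zero => rfl
  | succ j ih =>
    obtain ⟨i, hi⟩ := exists_add_mod_two_eq_zero j
    rw [altR_succ_of_even (lkY n m l) hi, Module.End.mul_apply, ih (by omega),
      show 2 * n - j = 2 * n - (j + 1) + 1 by omega, lkY_high hl (by omega) (by omega)]

theorem lkForm_zero_comp_altL_lkY (hm : m ≠ 0) (hl : l ≠ 0) {j : ℕ} (hj : j ≤ 2 * n) :
    lkForm n m l 0 ∘ₗ altL (lkY n m l 1) (lkY n m l 0) j = lkForm n m l j := by
  induction j with
  | zero => rfl
  | succ j ih =>
    obtain ⟨i, hi⟩ := exists_add_mod_two_eq_one j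
    rw [altL_succ_of_odd (lkY n m l) hi, Module.End.mul_eq_comp, ← LinearMap.comp_assoc,
      ih (by omega), lkForm_comp_lkY hm hl hj hi]

theorem lkForm_last_comp_altL_lkX (hm : m ≠ 0) (hl : l ≠ 0) {j : ℕ} (hj : j ≤ 2 * n) :
    lkForm n m l (2 * n) ∘ₗ altL (lkX n m l 0) (lkX n m l 1) j = lkForm n m l (2 * n - j) := by
  induction j with
  | zero => rfl
  | succ j ih =>
    obtain ⟨i, hi⟩ := exists_add_mod_two_eq_zero j
    rw [altL_succ_of_even (lkX n m l) hi, Module.End.mul_eq_comp, ← LinearMap.comp_assoc,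
      ih (by omega), show 2 * n - j = 2 * n - (j + 1) + 1 by omega,
      lkForm_succ_comp_lkX hm hl (by omega) (by omega)]

theorem altR_dualMap_apply {V : Type*} [AddCommGroup V] [Module F V] (a b : Module.End F V)
    (N : ℕ) (f : Module.Dual F V) :
    altR (A := Module.End F (Module.Dual F V)) a.dualMap b.dualMap N f = f ∘ₗ altL b a N := by
  induction N generalizing a b f with
  | zero => rfl
  | succ _ ih => exact ih b a (f ∘ₗ b)

theorem isLadder_lkY (hm : m ≠ 0) (hl : l ≠ 0) :
    IsLadder n m l⁻¹ (lkY n m l) (lkVec F n) where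
  apply_zero := lkY_end hm 0
  apply_high ha h := lkY_high hl ha h
  apply_low ha h := by rw [lkY_low ha h, lkCoeff_end_low ha h]

theorem isLadder_dualMap_lkX (hm : m ≠ 0) (hl : l ≠ 0) :
    IsLadder n (-m) l (fun i => (lkX n m l i).dualMap) (lkForm n m l) where
  apply_zero := lkForm_end_comp_lkX hm hl 0
  apply_high ha h := lkForm_succ_comp_lkX hm hl ha h
  apply_low {i a} ha h := by
    change lkForm n m l a ∘ₗ lkX n m l i = _
    rw [lkForm_comp_lkX hm hl ha h, lkCoeff_low_end ha h]
    module

theorem altL_lkX_lkVec_last (hm : m ≠ 0) (hl : l ≠ 0) :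
    altL (lkX n m l 1) (lkX n m l 0) (2 * n) (lkVec F n (2 * n)) = lkVec F n 0 := by
  rw [← (isLadder_lkY hm hl).altR_apply_last, altR_even, ← altR_even (lkX n m l 1),
    ← Module.End.mul_apply, altR_mul_altL_eq_one (lkX_mul_lkY hm hl 1) (lkX_mul_lkY hm hl 0),
    Module.End.one_apply]

theorem lkForm_zero_comp_altL_lkX (hm : m ≠ 0) (hl : l ≠ 0) :
    lkForm n m l 0 ∘ₗ altL (lkX n m l 1) (lkX n m l 0) (2 * n) = lkForm n m l (2 * n) := by
  rw [← altR_dualMap_apply]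
  exact (isLadder_dualMap_lkX hm hl).altR_apply_last

end LawrenceKrammerWords

section LawrenceKrammerRelations

variable {F : Type*} [Field F] {n : ℕ} {m l : F}

theorem altL_lkX_mul_lkE_zero (hm : m ≠ 0) (hl : l ≠ 0) :
    altL (lkX n m l 0) (lkX n m l 1) (2 * n) * lkE n m l 0 =
      lkE n m l 1 * altL (lkX n m l 0) (lkX n m l 1) (2 * n) := by
  refine LinearMap.ext fun x => ?_
  have form_last : lkForm n m l (2 * n) (altL (lkX n m l 0) (lkX n m l 1) (2 * n) x) =
      lkForm n m l 0 x := by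
    simpa using LinearMap.congr_fun (lkForm_last_comp_altL_lkX hm hl le_rfl) x
  have word_zero : altL (lkX n m l 0) (lkX n m l 1) (2 * n) (lkVec F n 0) = lkVec F n (2 * n) := by
    rw [← altR_even, altR_lkX_lkVec_zero le_rfl]
  simp only [Module.End.mul_apply, lkE_apply, ladderEnd, Matrix.cons_val_zero,
    Matrix.cons_val_one, Matrix.cons_val_fin_one, map_smul, form_last, word_zero]

theorem lkE_zero_mul_altL_lkX (hm : m ≠ 0) (hl : l ≠ 0) :
    lkE n m l 0 * altL (lkX n m l 1) (lkX n m l 0) (2 * n) =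
      altL (lkX n m l 1) (lkX n m l 0) (2 * n) * lkE n m l 1 := by
  refine LinearMap.ext fun x => ?_
  have form_zero : lkForm n m l 0 (altL (lkX n m l 1) (lkX n m l 0) (2 * n) x) =
      lkForm n m l (2 * n) x :=
    LinearMap.congr_fun (lkForm_zero_comp_altL_lkX hm hl) x
  simp only [Module.End.mul_apply, lkE_apply, ladderEnd, Matrix.cons_val_zero,
    Matrix.cons_val_one, Matrix.cons_val_fin_one, map_smul, form_zero,
    altL_lkX_lkVec_last hm hl]

theorem lkX_mul_lkX (hm : m ≠ 0) (hl : l ≠ 0) (i : Fin 2) :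
    lkX n m l i * lkX n m l i = 1 - m • lkX n m l i + (m * l) • lkE n m l i := by
  have h := lkY_mul_lkX (n := n) hm hl i
  rw [lkY, sub_mul, smul_mul_assoc, sub_mul, lkE_mul_lkX hm hl, one_mul] at h
  rw [← h]
  module

theorem intertwiner_defect_mul {A : Type*} [Ring A] [Algebra F A] {a b e e' T : A} {c : F}
    (ha : a * a = 1 - m • a + c • e) (hb : b * b = 1 - m • b + c • e') (he : T * e' = e * T) :
    (a * T - T * b) * b = -(a + m • 1) * (a * T - T * b) := by
  have left : a * (a * T) = T - m • (a * T) + c • (e * T) := by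
    rw [← mul_assoc, ha, add_mul, sub_mul, one_mul, smul_mul_assoc, smul_mul_assoc]
  have right : T * b * b = T - m • (T * b) + c • (e * T) := by
    rw [mul_assoc, hb, mul_add, mul_sub, mul_one, mul_smul_comm, mul_smul_comm, he]
  rw [sub_mul, right, neg_mul, add_mul, mul_sub, left, smul_mul_assoc, one_mul, mul_assoc a]
  module

theorem lkX_braid (hm : m ≠ 0) (hl : l ≠ 0) :
    altL (lkX n m l 0) (lkX n m l 1) (2 * n + 1) =
      altL (lkX n m l 1) (lkX n m l 0) (2 * n + 1) := by
  set T := altL (lkX n m l 0) (lkX n m l 1) (2 * n)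
  set T' := altL (lkX n m l 1) (lkX n m l 0) (2 * n)
  have left_eq : lkX n m l 0 * T' = T * lkX n m l 0 :=
    altL_succ_of_even (lkX n m l) (i := 0) (by simp)
  have right_eq : T' * lkX n m l 1 = lkX n m l 1 * T :=
    (altL_succ_of_odd (lkX n m l) (i := 1) (by simp)).symm
  set D := lkX n m l 0 * T' - T' * lkX n m l 1 with hD
  have D_mul : ∀ i : Fin 2, ∃ c : Module.End F (Fin (2 * n + 1) → F), D * lkX n m l i = c * D := by
    refine Fin.forall_fin_two.2 ⟨⟨-(lkX n m l 1 + m • 1), ?_⟩, _, intertwiner_defect_mul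
      (lkX_mul_lkX hm hl 0) (lkX_mul_lkX hm hl 1) (lkE_zero_mul_altL_lkX hm hl).symm⟩
    have h := intertwiner_defect_mul (lkX_mul_lkX hm hl 1) (lkX_mul_lkX hm hl 0)
      (altL_lkX_mul_lkE_zero (n := n) hm hl)
    rwa [← right_eq, ← left_eq, ← neg_sub, neg_mul D, mul_neg _ D, neg_inj] at h
  have D_lkVec_zero : D (lkVec F n 0) = 0 := by
    have T_zero : T (lkVec F n 0) = lkVec F n (2 * n) := by
      rw [← altR_lkX_lkVec_zero le_rfl, altR_even]
    rw [hD, left_eq, right_eq, LinearMap.sub_apply, Module.End.mul_apply, Module.End.mul_apply,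
      show lkX n m l 0 (lkVec F n 0) = l • lkVec F n 0 from lkX_end 0, map_smul, T_zero,
      show lkX n m l 1 (lkVec F n (2 * n)) = l • lkVec F n (2 * n) from lkX_end 1, sub_self]
  have D_lkVec : ∀ k ≤ 2 * n, D (lkVec F n k) = 0 := fun k hk => by
    induction k with
    | zero => exact D_lkVec_zero
    | succ k ih =>
      obtain ⟨i, hi⟩ := exists_add_mod_two_eq_one k
      obtain ⟨c, hc⟩ := D_mul i
      rw [← lkX_low hk hi, ← Module.End.mul_apply, hc, Module.End.mul_apply, ih (by omega),
        map_zero]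
  change lkX n m l 0 * T' = lkX n m l 1 * T
  rw [← right_eq, ← sub_eq_zero]
  exact stdVec_ext fun k hk => D_lkVec k (Nat.le_of_lt_succ hk)

theorem smulRight_mul_mul_smulRight {V : Type*} [AddCommGroup V] [Module F V]
    (f : Module.Dual F V) (u : V) (W : Module.End F V) :
    (f.smulRight u * W * f.smulRight u : Module.End F V) = f (W u) • f.smulRight u := by
  refine LinearMap.ext fun x => ?_
  simp [smul_smul, mul_comm]

theorem lkE_mul_lkE (i : Fin 2) :
    lkE n m l i * lkE n m l i = ((l - l⁻¹) / m + 1) • lkE n m l i := by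
  have h := smulRight_mul_mul_smulRight (lkForm n m l (ladderEnd n i)) (lkVec F n (ladderEnd n i)) 1
  rwa [mul_one, Module.End.one_apply, lkForm_lkVec _ (ladderEnd_le i), lkCoeff_self] at h

theorem lkE_mul_altL_lkX_mul_lkE (hm : m ≠ 0) (hl : l ≠ 0) (i : Fin 2) {k : ℕ} (hk : k < n) :
    lkE n m l i * altL (lkX n m l (1 - i)) (lkX n m l i) (2 * k + 1) * lkE n m l i =
      l⁻¹ • lkE n m l i := by
  rw [lkE, smulRight_mul_mul_smulRight]
  congr 1
  fin_cases i
  · change lkForm n m l 0 (altL (lkX n m l 1) (lkX n m l 0) (2 * k + 1) (lkVec F n 0)) = l⁻¹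
    rw [← altR_odd, altR_lkX_lkVec_zero (by omega), lkForm_lkVec _ (by omega),
      lkCoeff_of_gt (by omega) (by omega)]
  · change lkForm n m l (2 * n) (altL (lkX n m l 0) (lkX n m l 1) (2 * k + 1)
      (lkVec F n (2 * n))) = l⁻¹
    rw [← LinearMap.comp_apply, lkForm_last_comp_altL_lkX hm hl (by omega),
      lkForm_lkVec _ le_rfl, lkCoeff_of_gt (by omega) (by omega)]

theorem lkE_mul_altL_lkY_mul_lkE (hm : m ≠ 0) (hl : l ≠ 0) (i : Fin 2) {k : ℕ} (hk : k < n) :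
    lkE n m l i * altL (lkY n m l (1 - i)) (lkY n m l i) (2 * k + 1) * lkE n m l i =
      l • lkE n m l i := by
  rw [lkE, smulRight_mul_mul_smulRight]
  congr 1
  fin_cases i
  · change lkForm n m l 0 (altL (lkY n m l 1) (lkY n m l 0) (2 * k + 1) (lkVec F n 0)) = l
    rw [← LinearMap.comp_apply, lkForm_zero_comp_altL_lkY hm hl (by omega),
      lkForm_lkVec _ (Nat.zero_le _), lkCoeff_of_lt (by omega) (by omega)]
  · change lkForm n m l (2 * n) (altL (lkY n m l 0) (lkY n m l 1) (2 * k + 1)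
      (lkVec F n (2 * n))) = l
    rw [← altR_odd, altR_lkY_lkVec_last hl (by omega), lkForm_lkVec _ (by omega),
      lkCoeff_of_lt (by omega) (by omega)]

/-- The images of the generators in the Lawrence–Krammer representation. -/
noncomputable def lkGen (n : ℕ) (m l : F) : BMWGen → Module.End F (Fin (2 * n + 1) → F)
  | .X i => lkX n m l i
  | .Y i => lkY n m l i
  | .E i => lkE n m l i

theorem lift_lkGen_rel (hm : m ≠ 0) (hl : l ≠ 0) (x y : FreeAlgebra F BMWGen)
    (h : BMWRel n m l x y) :
    FreeAlgebra.lift F (lkGen n m l) x = FreeAlgebra.lift F (lkGen n m l) y := by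
  cases h with
  | mul_inv i => simpa [lkGen] using lkX_mul_lkY hm hl i
  | inv_mul i => simpa [lkGen] using lkY_mul_lkX hm hl i
  | braid => simpa [map_altL, lkGen] using lkX_braid hm hl
  | skein i => simp [lkGen, lkY]
  | X_mul_E i => simpa [lkGen] using lkX_mul_lkE i
  | E_mul_X i => simpa [lkGen] using lkE_mul_lkX hm hl i
  | E_mul_E i => simpa [lkGen] using lkE_mul_lkE i
  | E_X_E i k h1 h2 =>
    obtain ⟨k, rfl⟩ := Nat.exists_eq_add_of_le' h1
    rw [show 2 * (k + 1) - 1 = 2 * k + 1 by omega]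
    simpa [map_altL, lkGen] using lkE_mul_altL_lkX_mul_lkE hm hl i h2
  | E_Y_E i k h1 h2 =>
    obtain ⟨k, rfl⟩ := Nat.exists_eq_add_of_le' h1
    rw [show 2 * (k + 1) - 1 = 2 * k + 1 by omega]
    simpa [map_altL, lkGen] using lkE_mul_altL_lkY_mul_lkE hm hl i h2
  | X_E => simpa [map_altL, lkGen] using altL_lkX_mul_lkE_zero hm hl
  | E_X => simpa [map_altL, lkGen] using lkE_zero_mul_altL_lkX hm hl

/-- The Lawrence–Krammer representation of the dihedral BMW algebra. -/
noncomputable def lkRep (n : ℕ) {m l : F} (hm : m ≠ 0) (hl : l ≠ 0) :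
    BMW n m l →ₐ[F] Module.End F (Fin (2 * n + 1) → F) :=
  BMW.lift n m l (lkGen n m l) (lift_lkGen_rel hm hl)

theorem lkRep_gen (hm : m ≠ 0) (hl : l ≠ 0) (g : BMWGen) :
    lkRep n hm hl (BMW.gen n m l g) = lkGen n m l g := by
  rw [lkRep, BMW.gen, BMW.lift_mk, FreeAlgebra.lift_ι_apply]

end LawrenceKrammerRelations

section BMWAlgebra

variable {F : Type*} [Field F] {n : ℕ} {m l : F}

theorem BMW.mk_surjective : Function.Surjective (BMW.mk n m l) :=
  RingQuot.mkAlgHom_surjective F _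

theorem BMW.induction {P : BMW n m l → Prop} (halg : ∀ c, P (algebraMap F _ c))
    (hgen : ∀ g, P (BMW.gen n m l g)) (hadd : ∀ a b, P a → P b → P (a + b))
    (hmul : ∀ a b, P a → P b → P (a * b)) (b : BMW n m l) : P b := by
  obtain ⟨a, rfl⟩ := BMW.mk_surjective b
  induction a using FreeAlgebra.induction with
  | grade0 r => simpa using halg r
  | grade1 g => exact hgen g
  | mul a b ha hb => rw [map_mul]; exact hmul _ _ ha hb
  | add a b ha hb => rw [map_add]; exact hadd _ _ ha hb

theorem BMW.rev_gen (g : BMWGen) : BMW.rev n m l (BMW.gen n m l g) = BMW.gen n m l g := by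
  change (BMW.revHom n m l (BMW.mk n m l _)).unop = _
  rw [BMW.revHom, BMW.lift_mk, FreeAlgebra.lift_ι_apply, MulOpposite.unop_op]

theorem BMW.rev_mul (a b : BMW n m l) :
    BMW.rev n m l (a * b) = BMW.rev n m l b * BMW.rev n m l a := by
  change (BMW.revHom n m l (a * b)).unop = _
  rw [map_mul, MulOpposite.unop_mul]
  rfl

theorem BMW.rev_algebraMap (c : F) :
    BMW.rev n m l (algebraMap F _ c) = algebraMap F _ c := by
  change (BMW.revHom n m l (algebraMap F _ c)).unop = _
  rw [AlgHom.commutes]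
  rfl

theorem BMW.rev_one : BMW.rev n m l 1 = 1 := by
  simpa using BMW.rev_algebraMap (n := n) (m := m) (l := l) 1

theorem BMW.rev_rev (a : BMW n m l) : BMW.rev n m l (BMW.rev n m l a) = a := by
  induction a using BMW.induction with
  | halg c => rw [rev_algebraMap, rev_algebraMap]
  | hgen g => rw [rev_gen, rev_gen]
  | hadd a b ha hb => rw [map_add, map_add, ha, hb]
  | hmul a b ha hb => rw [rev_mul, rev_mul, ha, hb]

theorem BMW.rev_altR {a b : BMW n m l} (ha : BMW.rev n m l a = a) (hb : BMW.rev n m l b = b)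
    (N : ℕ) : BMW.rev n m l (altR a b N) = altL b a N := by
  induction N generalizing a b with
  | zero => exact BMW.rev_one
  | succ N ih =>
    change BMW.rev n m l (altR b a N * b) = b * altL a b N
    rw [rev_mul, ih hb ha, hb]

noncomputable abbrev BMW.Y (n : ℕ) (m l : F) (i : Fin 2) : BMW n m l := BMW.gen n m l (.Y i)

theorem BMW.X_mul_Y (i : Fin 2) : BMW.X n m l i * BMW.Y n m l i = 1 := by
  simpa [BMW.gen] using BMW.mk_rel (BMWRel.mul_inv (n := n) (m := m) (l := l) i)

theorem BMW.Y_mul_X (i : Fin 2) : BMW.Y n m l i * BMW.X n m l i = 1 := by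
  simpa [BMW.gen] using BMW.mk_rel (BMWRel.inv_mul (n := n) (m := m) (l := l) i)

theorem BMW.X_sub_Y (i : Fin 2) :
    BMW.X n m l i - BMW.Y n m l i = m • (BMW.E n m l i - 1) := by
  simpa [BMW.gen] using BMW.mk_rel (BMWRel.skein (n := n) (m := m) (l := l) i)

theorem BMW.X_mul_E (i : Fin 2) :
    BMW.X n m l i * BMW.E n m l i = l • BMW.E n m l i := by
  simpa [BMW.gen] using BMW.mk_rel (BMWRel.X_mul_E (n := n) (m := m) (l := l) i)

theorem BMW.E_mul_X (i : Fin 2) :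
    BMW.E n m l i * BMW.X n m l i = l • BMW.E n m l i := by
  simpa [BMW.gen] using BMW.mk_rel (BMWRel.E_mul_X (n := n) (m := m) (l := l) i)

theorem BMW.E_mul_E (i : Fin 2) :
    BMW.E n m l i * BMW.E n m l i = ((l - l⁻¹) / m + 1) • BMW.E n m l i := by
  simpa [BMW.gen] using BMW.mk_rel (BMWRel.E_mul_E (n := n) (m := m) (l := l) i)

theorem BMW.E_X_E (i : Fin 2) {k : ℕ} (hk : k < n) :
    BMW.E n m l i * altL (BMW.X n m l (1 - i)) (BMW.X n m l i) (2 * k + 1) * BMW.E n m l i =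
      l⁻¹ • BMW.E n m l i := by
  have h := BMW.mk_rel (BMWRel.E_X_E (n := n) (m := m) (l := l) i (k + 1) (by omega) hk)
  rw [show 2 * (k + 1) - 1 = 2 * k + 1 from rfl] at h
  simpa [BMW.gen, map_altL] using h

theorem BMW.E_Y_E (i : Fin 2) {k : ℕ} (hk : k < n) :
    BMW.E n m l i * altL (BMW.Y n m l (1 - i)) (BMW.Y n m l i) (2 * k + 1) * BMW.E n m l i =
      l • BMW.E n m l i := by
  have h := BMW.mk_rel (BMWRel.E_Y_E (n := n) (m := m) (l := l) i (k + 1) (by omega) hk)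
  rw [show 2 * (k + 1) - 1 = 2 * k + 1 from rfl] at h
  simpa [BMW.gen, map_altL] using h

theorem BMW.X_E : altL (BMW.X n m l 0) (BMW.X n m l 1) (2 * n) * BMW.E n m l 0 =
    BMW.E n m l 1 * altL (BMW.X n m l 0) (BMW.X n m l 1) (2 * n) := by
  simpa [BMW.gen, map_altL] using BMW.mk_rel (BMWRel.X_E (n := n) (m := m) (l := l))

theorem BMW.X_mul_X (i : Fin 2) : BMW.X n m l i * BMW.X n m l i =
    1 - m • BMW.X n m l i + (m * l) • BMW.E n m l i := by
  have h := congrArg (· * BMW.X n m l i) (BMW.X_sub_Y (n := n) (m := m) (l := l) i)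
  simp only [sub_mul, Y_mul_X, smul_mul_assoc, E_mul_X, one_mul] at h
  rw [sub_eq_iff_eq_add.1 h]
  module

/-- The elements `[⋯ X_0 X_1]_k E_0`, which for `k ≤ 2n` span the left ideal of `E_0`. -/
noncomputable def BMW.col (n : ℕ) (m l : F) (k : ℕ) : BMW n m l :=
  altR (BMW.X n m l 0) (BMW.X n m l 1) k * BMW.E n m l 0

theorem BMW.col_zero : BMW.col n m l 0 = BMW.E n m l 0 := one_mul _

theorem BMW.col_succ {i : Fin 2} {k : ℕ} (h : (k + i) % 2 = 1) :
    BMW.col n m l (k + 1) = BMW.X n m l i * BMW.col n m l k := by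
  rw [col, altR_succ_of_odd (BMW.X n m l) h, mul_assoc, col]

theorem BMW.col_last : BMW.col n m l (2 * n) =
    BMW.E n m l 1 * altL (BMW.X n m l 0) (BMW.X n m l 1) (2 * n) := by
  rw [col, altR_even, X_E]

theorem BMW.exists_col_ladderEnd_eq (n : ℕ) (m l : F) (i : Fin 2) :
    ∃ t, BMW.col n m l (ladderEnd n i) = BMW.E n m l i * t := by
  fin_cases i
  · exact ⟨1, by simp [ladderEnd, col_zero]⟩
  · exact ⟨_, col_last⟩

theorem BMW.X_mul_col_ladderEnd (i : Fin 2) :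
    BMW.X n m l i * BMW.col n m l (ladderEnd n i) = l • BMW.col n m l (ladderEnd n i) := by
  obtain ⟨t, ht⟩ := BMW.exists_col_ladderEnd_eq n m l i
  rw [ht, ← mul_assoc, X_mul_E, smul_mul_assoc]

theorem BMW.altR_Y_mul_col_last {j : ℕ} (hj : j ≤ 2 * n) :
    altR (BMW.Y n m l 1) (BMW.Y n m l 0) j * BMW.col n m l (2 * n) =
      BMW.col n m l (2 * n - j) := by
  induction j with
  | zero => exact one_mul _
  | succ j ih =>
    obtain ⟨i, hi⟩ := exists_add_mod_two_eq_zero j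
    rw [altR_succ_of_even (BMW.Y n m l) hi, mul_assoc, ih (by omega),
      show 2 * n - j = 2 * n - (j + 1) + 1 by omega, col_succ (i := i) (by omega), ← mul_assoc,
      Y_mul_X, one_mul]

theorem BMW.E_mul_col_succ {i : Fin 2} {a : ℕ} (h : (a + i) % 2 = 1) :
    BMW.E n m l i * BMW.col n m l (a + 1) = l • (BMW.E n m l i * BMW.col n m l a) := by
  rw [col_succ h, ← mul_assoc, E_mul_X, smul_mul_assoc]

theorem BMW.E_zero_mul_col_odd {p : ℕ} (hp : p < n) :
    BMW.E n m l 0 * BMW.col n m l (2 * p + 1) = l⁻¹ • BMW.col n m l 0 := by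
  rw [col_zero, col, altR_odd, ← mul_assoc]
  exact E_X_E 0 hp

theorem BMW.E_one_mul_col_odd {p : ℕ} (hp : p < n) :
    BMW.E n m l 1 * BMW.col n m l (2 * p + 1) = l • BMW.col n m l (2 * n) := by
  have h : BMW.E n m l 1 * altL (BMW.Y n m l 0) (BMW.Y n m l 1) (2 * (n - 1 - p) + 1) *
      BMW.E n m l 1 = l • BMW.E n m l 1 := BMW.E_Y_E 1 (by omega)
  rw [show 2 * p + 1 = 2 * n - (2 * (n - 1 - p) + 1) by omega, ← altR_Y_mul_col_last (by omega),
    altR_odd, col_last, ← mul_assoc, ← mul_assoc, h, smul_mul_assoc]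

theorem BMW.E_mul_col_low (hl : l ≠ 0) {i : Fin 2} {a : ℕ} (ha : a < 2 * n)
    (h : (a + i) % 2 = 1) : BMW.E n m l i * BMW.col n m l a =
      lkCoeff m l (ladderEnd n i) a • BMW.col n m l (ladderEnd n i) := by
  rw [lkCoeff_end_low ha h]
  fin_cases i
  · obtain ⟨p, rfl⟩ : Odd a := Nat.odd_iff.2 h
    exact E_zero_mul_col_odd (by omega)
  · obtain ⟨p, rfl⟩ : ∃ p, a = 2 * p := even_iff_exists_two_mul.1 (by grind)
    refine smul_right_injective _ hl ?_
    change l • (BMW.E n m l 1 * _) = l • (1 : F) • BMW.col n m l (2 * n)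
    rw [← E_mul_col_succ (i := 1) h, E_one_mul_col_odd (by omega), one_smul]

theorem BMW.E_mul_col (hl : l ≠ 0) (i : Fin 2) {k : ℕ} (hk : k ≤ 2 * n) :
    BMW.E n m l i * BMW.col n m l k =
      lkCoeff m l (ladderEnd n i) k • BMW.col n m l (ladderEnd n i) := by
  refine ladder_cases i (P := fun k => BMW.E n m l i * BMW.col n m l k =
    lkCoeff m l (ladderEnd n i) k • BMW.col n m l (ladderEnd n i)) ?_
    (fun a ha h => E_mul_col_low hl ha h) (fun a ha h => ?_) hk
  · obtain ⟨t, ht⟩ := BMW.exists_col_ladderEnd_eq n m l i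
    rw [ht, ← mul_assoc, E_mul_E, lkCoeff_self, smul_mul_assoc]
  · rw [E_mul_col_succ h, E_mul_col_low hl ha h, smul_smul, mul_lkCoeff_end_low hl ha h]

theorem BMW.X_mul_col_high (hl : l ≠ 0) {i : Fin 2} {a : ℕ} (ha : a < 2 * n)
    (h : (a + i) % 2 = 1) : BMW.X n m l i * BMW.col n m l (a + 1) =
      BMW.col n m l a - m • BMW.col n m l (a + 1) +
        (m * l * lkCoeff m l (ladderEnd n i) a) • BMW.col n m l (ladderEnd n i) := by
  rw [col_succ h, ← mul_assoc, X_mul_X, add_mul, sub_mul, one_mul, smul_mul_assoc, smul_mul_assoc,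
    E_mul_col hl i ha.le, smul_smul]

/-- The linear map onto the left ideal of `E_0` that sends the basis of the Lawrence–Krammer
representation to the elements `BMW.col n m l k`. -/
noncomputable def BMW.lkColumn (n : ℕ) (m l : F) : (Fin (2 * n + 1) → F) →ₗ[F] BMW n m l :=
  Fintype.linearCombination F fun k : Fin (2 * n + 1) => BMW.col n m l k

theorem BMW.lkColumn_lkVec {k : ℕ} (hk : k ≤ 2 * n) :
    BMW.lkColumn n m l (lkVec F n k) = BMW.col n m l k :=
  linearCombination_stdVec (BMW.col n m l) (Nat.lt_succ_of_le hk)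

theorem BMW.X_mul_lkColumn (hl : l ≠ 0) (i : Fin 2) (w : Fin (2 * n + 1) → F) :
    BMW.X n m l i * BMW.lkColumn n m l w = BMW.lkColumn n m l (lkX n m l i w) := by
  suffices LinearMap.mulLeft F (BMW.X n m l i) ∘ₗ BMW.lkColumn n m l =
      BMW.lkColumn n m l ∘ₗ lkX n m l i from LinearMap.congr_fun this w
  refine lkVec_ext i ?_ (fun a ha h => ?_) (fun a ha h => ?_) <;>
    rw [LinearMap.comp_apply, LinearMap.comp_apply, LinearMap.mulLeft_apply]
  · rw [lkX_end, map_smul, lkColumn_lkVec (ladderEnd_le i), X_mul_col_ladderEnd]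
  · rw [lkX_low ha h, lkColumn_lkVec ha.le, lkColumn_lkVec ha, col_succ h]
  · rw [lkX_high ha h, map_add, map_sub, map_smul, map_smul, lkColumn_lkVec ha,
      lkColumn_lkVec ha.le, lkColumn_lkVec (ladderEnd_le i), X_mul_col_high hl ha h]

theorem BMW.E_mul_lkColumn (hl : l ≠ 0) (i : Fin 2) (w : Fin (2 * n + 1) → F) :
    BMW.E n m l i * BMW.lkColumn n m l w = BMW.lkColumn n m l (lkE n m l i w) := by
  suffices LinearMap.mulLeft F (BMW.E n m l i) ∘ₗ BMW.lkColumn n m l =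
      BMW.lkColumn n m l ∘ₗ lkE n m l i from LinearMap.congr_fun this w
  refine stdVec_ext fun k hk => ?_
  have hk : k ≤ 2 * n := Nat.le_of_lt_succ hk
  rw [LinearMap.comp_apply, LinearMap.comp_apply, LinearMap.mulLeft_apply, lkE_lkVec i hk,
    map_smul, lkColumn_lkVec hk, lkColumn_lkVec (ladderEnd_le i), E_mul_col hl i hk]

theorem BMW.mul_lkColumn (hm : m ≠ 0) (hl : l ≠ 0) (b : BMW n m l) (w : Fin (2 * n + 1) → F) :
    b * BMW.lkColumn n m l w = BMW.lkColumn n m l (lkRep n hm hl b w) := by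
  induction b using BMW.induction generalizing w with
  | halg c => rw [← Algebra.smul_def, AlgHom.commutes, Module.algebraMap_end_apply, map_smul]
  | hadd a b ha hb => rw [add_mul, ha, hb, map_add, LinearMap.add_apply, map_add]
  | hmul a b ha hb => rw [mul_assoc, hb, ha, map_mul, Module.End.mul_apply]
  | hgen g =>
    rw [lkRep_gen]
    cases g with
    | X i => exact X_mul_lkColumn hl i w
    | E i => exact E_mul_lkColumn hl i w
    | Y i =>
      have hY : BMW.Y n m l i = BMW.X n m l i - m • (BMW.E n m l i - 1) := by
        rw [← X_sub_Y, sub_sub_cancel]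
      change BMW.Y n m l i * _ = _
      rw [hY, lkGen, lkY_apply, sub_mul, smul_mul_assoc, sub_mul, one_mul, X_mul_lkColumn hl,
        E_mul_lkColumn hl, map_add, map_sub, map_smul, map_smul]
      module

theorem BMW.mul_col (hm : m ≠ 0) (hl : l ≠ 0) (b : BMW n m l) {k : ℕ} (hk : k ≤ 2 * n) :
    b * BMW.col n m l k =
      ∑ k' : Fin (2 * n + 1), lkRep n hm hl b (lkVec F n k) k' • BMW.col n m l k' := by
  rw [← lkColumn_lkVec hk, mul_lkColumn hm hl, lkColumn, Fintype.linearCombination_apply]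

/-- The elements `[⋯ X_0 X_1]_i E_0 [X_1 X_0 ⋯]_j` of the Lawrence–Krammer cell. -/
noncomputable def BMW.lkElement (n : ℕ) (m l : F) (i j : Fin (2 * n + 1)) : BMW n m l :=
  altR (BMW.X n m l 0) (BMW.X n m l 1) i * BMW.E n m l 0 *
    altL (BMW.X n m l 1) (BMW.X n m l 0) j

theorem BMW.lkElement_eq (i j : Fin (2 * n + 1)) : BMW.lkElement n m l i j =
    BMW.col n m l i * altL (BMW.X n m l 1) (BMW.X n m l 0) j := rfl

theorem BMW.rev_lkElement (i j : Fin (2 * n + 1)) :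
    BMW.rev n m l (BMW.lkElement n m l i j) = BMW.lkElement n m l j i := by
  have hX : ∀ i, BMW.rev n m l (BMW.X n m l i) = BMW.X n m l i := fun i => rev_gen _
  rw [lkElement, rev_mul, rev_mul, rev_altR (hX 0) (hX 1), rev_gen, ← rev_altR (hX 0) (hX 1),
    rev_rev, lkElement, mul_assoc]

theorem BMW.mul_lkElement (hm : m ≠ 0) (hl : l ≠ 0) (b : BMW n m l) (i j : Fin (2 * n + 1)) :
    b * BMW.lkElement n m l i j =
      ∑ i' : Fin (2 * n + 1), lkRep n hm hl b (lkVec F n i) i' • BMW.lkElement n m l i' j := by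
  simp only [lkElement_eq, ← mul_assoc, mul_col hm hl b (Nat.le_of_lt_succ i.2), Finset.sum_mul,
    smul_mul_assoc]

/-- The span of the Lawrence–Krammer cell. -/
noncomputable def BMW.lkSpan (n : ℕ) (m l : F) : Submodule F (BMW n m l) :=
  Submodule.span F (Set.range fun x : Fin (2 * n + 1) × Fin (2 * n + 1) =>
    BMW.lkElement n m l x.1 x.2)

theorem BMW.lkElement_mem (i j : Fin (2 * n + 1)) :
    BMW.lkElement n m l i j ∈ BMW.lkSpan n m l :=
  Submodule.subset_span ⟨(i, j), rfl⟩

theorem BMW.mul_mem_lkSpan (hm : m ≠ 0) (hl : l ≠ 0) (b : BMW n m l) {x : BMW n m l}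
    (hx : x ∈ BMW.lkSpan n m l) : b * x ∈ BMW.lkSpan n m l := by
  suffices BMW.lkSpan n m l ≤ (BMW.lkSpan n m l).comap (LinearMap.mulLeft F b) from this hx
  refine Submodule.span_le.2 ?_
  rintro _ ⟨⟨i, j⟩, rfl⟩
  change b * BMW.lkElement n m l i j ∈ BMW.lkSpan n m l
  rw [mul_lkElement hm hl]
  exact Submodule.sum_mem _ fun i' _ => Submodule.smul_mem _ _ (lkElement_mem i' j)

theorem BMW.rev_mem_lkSpan {x : BMW n m l} (hx : x ∈ BMW.lkSpan n m l) :
    BMW.rev n m l x ∈ BMW.lkSpan n m l := by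
  suffices BMW.lkSpan n m l ≤ (BMW.lkSpan n m l).comap (BMW.rev n m l) from this hx
  refine Submodule.span_le.2 ?_
  rintro _ ⟨⟨i, j⟩, rfl⟩
  change BMW.rev n m l (BMW.lkElement n m l i j) ∈ BMW.lkSpan n m l
  rw [rev_lkElement]
  exact lkElement_mem j i

theorem BMW.mem_lkSpan_mul (hm : m ≠ 0) (hl : l ≠ 0) (b : BMW n m l) {x : BMW n m l}
    (hx : x ∈ BMW.lkSpan n m l) : x * b ∈ BMW.lkSpan n m l := by
  have h := rev_mem_lkSpan (mul_mem_lkSpan hm hl (BMW.rev n m l b) (rev_mem_lkSpan hx))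
  rwa [rev_mul, rev_rev, rev_rev] at h

theorem BMW.E_mem_lkSpan (hm : m ≠ 0) (hl : l ≠ 0) (i : Fin 2) :
    BMW.E n m l i ∈ BMW.lkSpan n m l := by
  have h0 : BMW.E n m l 0 ∈ BMW.lkSpan n m l := by
    have h := lkElement_mem (n := n) (m := m) (l := l) 0 0
    rwa [lkElement_eq, Fin.val_zero, col_zero, altL, mul_one] at h
  fin_cases i
  · exact h0
  · have h := mem_lkSpan_mul hm hl (altL (BMW.Y n m l 1) (BMW.Y n m l 0) (2 * n))
      (mul_mem_lkSpan hm hl (altL (BMW.X n m l 0) (BMW.X n m l 1) (2 * n)) h0)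
    rwa [X_E, mul_assoc, ← altR_even, altR_mul_altL_eq_one (X_mul_Y 0) (X_mul_Y 1),
      mul_one] at h

end BMWAlgebra

section HeckeAlgebra

variable {F : Type*} [Field F] {n : ℕ} {v : F}

theorem Hecke.mk_surjective : Function.Surjective (Hecke.mk n v) :=
  RingQuot.mkAlgHom_surjective F _

theorem Hecke.induction {P : Hecke n v → Prop} (halg : ∀ c, P (algebraMap F _ c))
    (hx : ∀ i, P (Hecke.x n v i)) (hadd : ∀ a b, P a → P b → P (a + b))
    (hmul : ∀ a b, P a → P b → P (a * b)) (b : Hecke n v) : P b := by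
  obtain ⟨a, rfl⟩ := Hecke.mk_surjective b
  induction a using FreeAlgebra.induction with
  | grade0 r => simpa using halg r
  | grade1 g => exact hx g
  | mul a b ha hb => rw [map_mul]; exact hmul _ _ ha hb
  | add a b ha hb => rw [map_add]; exact hadd _ _ ha hb

theorem Hecke.rev_x (i : Fin 2) : Hecke.rev n v (Hecke.x n v i) = Hecke.x n v i := by
  change (Hecke.revHom n v (Hecke.mk n v _)).unop = _
  rw [Hecke.revHom, Hecke.lift_mk, FreeAlgebra.lift_ι_apply, MulOpposite.unop_op]

theorem Hecke.rev_mul (a b : Hecke n v) :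
    Hecke.rev n v (a * b) = Hecke.rev n v b * Hecke.rev n v a := by
  change (Hecke.revHom n v (a * b)).unop = _
  rw [map_mul, MulOpposite.unop_mul]
  rfl

theorem Hecke.rev_algebraMap (c : F) :
    Hecke.rev n v (algebraMap F _ c) = algebraMap F _ c := by
  change (Hecke.revHom n v (algebraMap F _ c)).unop = _
  rw [AlgHom.commutes]
  rfl

theorem Hecke.rev_rev (a : Hecke n v) : Hecke.rev n v (Hecke.rev n v a) = a := by
  induction a using Hecke.induction with
  | halg c => rw [rev_algebraMap, rev_algebraMap]
  | hx i => rw [rev_x, rev_x]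
  | hadd a b ha hb => rw [map_add, map_add, ha, hb]
  | hmul a b ha hb => rw [rev_mul, rev_mul, ha, hb]

end HeckeAlgebra

section QuotientMap

variable {F : Type*} [Field F] {n : ℕ} {v l : F} (hv : v ≠ 0)

theorem toHecke_gen (g : BMWGen) :
    toHecke n v l hv (BMW.gen n (v - v⁻¹) l g) = toHeckeGen n v g := by
  rw [toHecke, BMW.gen, BMW.lift_mk, FreeAlgebra.lift_ι_apply]

theorem toHecke_surjective : Function.Surjective (toHecke n v l hv) := by
  rw [← AlgHom.range_eq_top, eq_top_iff]
  rintro b -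
  induction b using Hecke.induction with
  | halg c => exact Subalgebra.algebraMap_mem _ c
  | hx i => exact ⟨_, toHecke_gen hv (.X i)⟩
  | hadd a b ha hb => exact Subalgebra.add_mem _ ha hb
  | hmul a b ha hb => exact Subalgebra.mul_mem _ ha hb

theorem toHecke_rev (b : BMW n (v - v⁻¹) l) :
    toHecke n v l hv (BMW.rev n (v - v⁻¹) l b) = Hecke.rev n v (toHecke n v l hv b) := by
  induction b using BMW.induction with
  | halg c => rw [BMW.rev_algebraMap, AlgHom.commutes, Hecke.rev_algebraMap]
  | hadd a b ha hb => simp only [map_add, ha, hb]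
  | hmul a b ha hb => rw [BMW.rev_mul, map_mul, map_mul, Hecke.rev_mul, ha, hb]
  | hgen g =>
    rw [BMW.rev_gen, toHecke_gen]
    cases g with
    | X i => exact (Hecke.rev_x i).symm
    | E i => exact (map_zero _).symm
    | Y i => rw [toHeckeGen, map_add, Hecke.rev_x, Hecke.rev_algebraMap]

theorem toHecke_lkElement (i j : Fin (2 * n + 1)) :
    toHecke n v l hv (BMW.lkElement n (v - v⁻¹) l i j) = 0 := by
  rw [BMW.lkElement, map_mul, map_mul, toHecke_gen, toHeckeGen, mul_zero, zero_mul]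

end QuotientMap

section Kernel

variable {F : Type*} [Field F] {n : ℕ} {v l : F}

/-- The Lawrence–Krammer ideal: the two-sided ideal with underlying space `BMW.lkSpan`. -/
noncomputable def BMW.lkIdeal (n : ℕ) {m l : F} (hm : m ≠ 0) (hl : l ≠ 0) :
    Ideal (BMW n m l) where
  carrier := BMW.lkSpan n m l
  add_mem' := Submodule.add_mem _
  zero_mem' := Submodule.zero_mem _
  smul_mem' b _ hx := BMW.mul_mem_lkSpan hm hl b hx

instance BMW.lkIdeal_isTwoSided {m l : F} (hm : m ≠ 0) (hl : l ≠ 0) :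
    (BMW.lkIdeal n hm hl).IsTwoSided :=
  ⟨fun b hx => BMW.mem_lkSpan_mul hm hl b hx⟩

theorem BMW.mkₐ_lkIdeal_E {m l : F} (hm : m ≠ 0) (hl : l ≠ 0) (i : Fin 2) :
    Ideal.Quotient.mkₐ F (BMW.lkIdeal n hm hl) (BMW.E n m l i) = 0 :=
  Ideal.Quotient.eq_zero_iff_mem.2 (BMW.E_mem_lkSpan hm hl i)

theorem BMW.X_quadratic (hv : v ≠ 0) (i : Fin 2) :
    (BMW.X n (v - v⁻¹) l i + algebraMap F _ v) * (BMW.X n (v - v⁻¹) l i - algebraMap F _ v⁻¹) =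
      ((v - v⁻¹) * l) • BMW.E n (v - v⁻¹) l i := by
  have h := BMW.X_mul_X (n := n) (m := v - v⁻¹) (l := l) i
  simp only [Algebra.algebraMap_eq_smul_one, add_mul, mul_sub, smul_mul_assoc, mul_smul_comm,
    one_mul, mul_one, smul_add, inv_smul_smul₀ hv, h]
  module

variable (hv : v ≠ 0) (hm : v - v⁻¹ ≠ 0) (hl : l ≠ 0)

include hv in
theorem lift_mkₐ_X_rel (x y : FreeAlgebra F (Fin 2)) (h : HeckeRel n v x y) :
    FreeAlgebra.lift F
        (fun i => Ideal.Quotient.mkₐ F (BMW.lkIdeal n hm hl) (BMW.X n (v - v⁻¹) l i)) x =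
      FreeAlgebra.lift F
        (fun i => Ideal.Quotient.mkₐ F (BMW.lkIdeal n hm hl) (BMW.X n (v - v⁻¹) l i)) y := by
  cases h with
  | braid =>
    have braid : altL (BMW.X n (v - v⁻¹) l 0) (BMW.X n (v - v⁻¹) l 1) (2 * n + 1) =
        altL (BMW.X n (v - v⁻¹) l 1) (BMW.X n (v - v⁻¹) l 0) (2 * n + 1) := by
      simpa [BMW.gen, map_altL] using BMW.mk_rel (BMWRel.braid (n := n) (m := v - v⁻¹) (l := l))
    simpa only [map_altL, FreeAlgebra.lift_ι_apply] using
      congrArg (Ideal.Quotient.mkₐ F (BMW.lkIdeal n hm hl)) braid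
  | quadratic i =>
    have quadratic : Ideal.Quotient.mkₐ F (BMW.lkIdeal n hm hl)
        ((BMW.X n (v - v⁻¹) l i + algebraMap F _ v) *
          (BMW.X n (v - v⁻¹) l i - algebraMap F _ v⁻¹)) = 0 := by
      rw [BMW.X_quadratic hv, map_smul, BMW.mkₐ_lkIdeal_E, smul_zero]
    simpa only [map_mul, map_add, map_sub, map_zero, FreeAlgebra.lift_ι_apply,
      AlgHom.commutes] using quadratic

/-- The homomorphism from the Hecke algebra to the quotient of the BMW algebra by the
Lawrence–Krammer ideal with `x_i ↦ X_i`, an inverse of the map induced by `toHecke`. -/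
noncomputable def heckeToQuotient :
    Hecke n v →ₐ[F] BMW n (v - v⁻¹) l ⧸ BMW.lkIdeal n hm hl :=
  Hecke.lift n v (fun i => Ideal.Quotient.mkₐ F (BMW.lkIdeal n hm hl) (BMW.X n (v - v⁻¹) l i))
    (lift_mkₐ_X_rel hv hm hl)

theorem heckeToQuotient_x (i : Fin 2) :
    heckeToQuotient hv hm hl (Hecke.x n v i) =
      Ideal.Quotient.mkₐ F (BMW.lkIdeal n hm hl) (BMW.X n (v - v⁻¹) l i) := by
  rw [heckeToQuotient, Hecke.x, Hecke.lift_mk, FreeAlgebra.lift_ι_apply]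

theorem heckeToQuotient_toHecke (b : BMW n (v - v⁻¹) l) :
    heckeToQuotient hv hm hl (toHecke n v l hv b) =
      Ideal.Quotient.mkₐ F (BMW.lkIdeal n hm hl) b := by
  induction b using BMW.induction with
  | halg c => simp only [AlgHom.commutes]
  | hadd a b ha hb => rw [map_add, map_add, map_add, ha, hb]
  | hmul a b ha hb => rw [map_mul, map_mul, map_mul, ha, hb]
  | hgen g =>
    rw [toHecke_gen]
    cases g with
    | X i => exact heckeToQuotient_x hv hm hl i
    | E i => rw [toHeckeGen, map_zero]; exact (BMW.mkₐ_lkIdeal_E hm hl i).symm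
    | Y i =>
      have hY : BMW.gen n (v - v⁻¹) l (.Y i) =
          BMW.X n (v - v⁻¹) l i - (v - v⁻¹) • (BMW.E n (v - v⁻¹) l i - 1) := by
        rw [← BMW.X_sub_Y, sub_sub_cancel]
      have quotient_E_sub_one : Ideal.Quotient.mkₐ F (BMW.lkIdeal n hm hl)
          (BMW.E n (v - v⁻¹) l i - 1) = -1 := by
        rw [map_sub, BMW.mkₐ_lkIdeal_E, zero_sub, map_one]
      rw [toHeckeGen, map_add, heckeToQuotient_x, AlgHom.commutes, hY,
        map_sub (Ideal.Quotient.mkₐ F (BMW.lkIdeal n hm hl)), map_smul, quotient_E_sub_one,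
        smul_neg, sub_neg_eq_add, Algebra.algebraMap_eq_smul_one]

include hm hl in
theorem mem_lkSpan_of_toHecke_eq_zero {b : BMW n (v - v⁻¹) l} (hb : toHecke n v l hv b = 0) :
    b ∈ BMW.lkSpan n (v - v⁻¹) l := by
  have h := heckeToQuotient_toHecke hv hm hl b
  rw [hb, map_zero] at h
  exact Ideal.Quotient.eq_zero_iff_mem.1 h.symm

end Kernel

section Independence

variable {F : Type*} [Field F] {n : ℕ} {m l : F}

/-- The Gram matrix of the bilinear form on the Lawrence–Krammer cell. -/
def lkGram (N : ℕ) (m l : F) : Matrix (Fin N) (Fin N) F := Matrix.of fun j k => lkCoeff m l j k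

theorem lkForm_linearIndependent (hdet : (lkGram (2 * n + 1) m l).det ≠ 0) :
    LinearIndependent F (fun j : Fin (2 * n + 1) => lkForm n m l j) := by
  refine Fintype.linearIndependent_iff.2 fun c hc => ?_
  refine congrFun (Matrix.eq_zero_of_vecMul_eq_zero hdet (funext fun k => ?_))
  have h := LinearMap.congr_fun hc (lkVec F n k)
  simp only [LinearMap.sum_apply, LinearMap.smul_apply,
    lkForm_lkVec _ (Nat.le_of_lt_succ k.2)] at h
  exact h

theorem lkRep_rev_altR_mul_E_zero (hm : m ≠ 0) (hl : l ≠ 0) {g : Fin 2 → BMWGen} (k : ℕ) :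
    lkRep n hm hl (BMW.rev n m l
      (altR (BMW.gen n m l (g 0)) (BMW.gen n m l (g 1)) k * BMW.E n m l 0)) =
      lkE n m l 0 * altL (lkGen n m l (g 1)) (lkGen n m l (g 0)) k := by
  rw [BMW.rev_mul, BMW.rev_altR (BMW.rev_gen _) (BMW.rev_gen _), BMW.rev_gen, map_mul, map_altL,
    lkRep_gen, lkRep_gen, lkRep_gen, lkGen]

theorem lkForm_mem_span (hm : m ≠ 0) (hl : l ≠ 0) (j : Fin (2 * n + 1)) :
    lkForm n m l j ∈ Submodule.span F (Set.range fun k : Fin (2 * n + 1) =>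
      lkForm n m l 0 ∘ₗ altL (lkX n m l 1) (lkX n m l 0) k) := by
  have expand := BMW.mul_col hm hl (altR (BMW.Y n m l 0) (BMW.Y n m l 1) j) (Nat.zero_le (2 * n))
  rw [BMW.col_zero] at expand
  have act := congrArg (fun b => lkRep n hm hl (BMW.rev n m l b)) expand
  simp only [map_sum, map_smul, BMW.col, lkRep_rev_altR_mul_E_zero hm hl (g := .X),
    lkRep_rev_altR_mul_E_zero hm hl (g := .Y), lkGen] at act
  refine (Submodule.mem_span_range_iff_exists_fun F).2 ⟨fun k => lkRep n hm hl
    (altR (BMW.Y n m l 0) (BMW.Y n m l 1) j) (lkVec F n 0) k, LinearMap.ext fun x => ?_⟩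
  have coord := congrFun (LinearMap.congr_fun act x) 0
  rw [Module.End.mul_apply, lkE_apply, ladderEnd] at coord
  rw [← lkForm_zero_comp_altL_lkY hm hl (Nat.le_of_lt_succ j.2)]
  simpa [lkE_apply, ladderEnd, stdVec] using coord.symm

theorem lkForm_comp_altL_linearIndependent (hm : m ≠ 0) (hl : l ≠ 0)
    (hdet : (lkGram (2 * n + 1) m l).det ≠ 0) :
    LinearIndependent F (fun k : Fin (2 * n + 1) =>
      lkForm n m l 0 ∘ₗ altL (lkX n m l 1) (lkX n m l 0) k) := by
  have hcard : Fintype.card (Fin (2 * n + 1)) =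
      Module.finrank F (Module.Dual F (Fin (2 * n + 1) → F)) := by
    rw [Subspace.dual_finrank_eq, Module.finrank_fintype_fun_eq_card]
  refine linearIndependent_of_top_le_span_of_card_eq_finrank ?_ hcard
  rw [← (lkForm_linearIndependent hdet).span_eq_top_of_card_eq_finrank' hcard]
  exact Submodule.span_le.2 (Set.range_subset_iff.2 (lkForm_mem_span hm hl))

theorem lkRep_lkElement_apply (hm : m ≠ 0) (hl : l ≠ 0) (i j : Fin (2 * n + 1))
    (x : Fin (2 * n + 1) → F) : lkRep n hm hl (BMW.lkElement n m l i j) x =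
      Pi.single i (lkForm n m l 0 (altL (lkX n m l 1) (lkX n m l 0) j x)) := by
  have word : altR (lkX n m l 0) (lkX n m l 1) i (lkVec F n 0) = Pi.single i 1 := by
    rw [altR_lkX_lkVec_zero (Nat.le_of_lt_succ i.2), lkVec, stdVec_coe]
  rw [BMW.lkElement, map_mul, map_mul, map_altR, map_altL]
  simp only [lkRep_gen, lkGen, Module.End.mul_apply, lkE_apply, ladderEnd, Matrix.cons_val_zero,
    map_smul, word]
  rw [← Pi.single_smul, smul_eq_mul, mul_one]

theorem lkElement_linearIndependent (hm : m ≠ 0) (hl : l ≠ 0)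
    (hdet : (lkGram (2 * n + 1) m l).det ≠ 0) :
    LinearIndependent F (fun x : Fin (2 * n + 1) × Fin (2 * n + 1) =>
      BMW.lkElement n m l x.1 x.2) := by
  refine Fintype.linearIndependent_iff.2 fun c hc => ?_
  rintro ⟨i, j⟩
  have forms_indep := lkForm_comp_altL_linearIndependent hm hl hdet
  rw [Fintype.linearIndependent_iff] at forms_indep
  refine forms_indep (fun k => c (i, k)) (LinearMap.ext fun x => ?_) j
  have coord := congrFun (LinearMap.congr_fun (congrArg (lkRep n hm hl) hc) x) i
  simpa [lkRep_lkElement_apply, Fintype.sum_prod_type_right, Finset.sum_apply,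
    Pi.single_apply] using coord

end Independence

section Generic

variable {F : Type*} [Field F] [CharZero F] {v l : F}

/-- The Gram matrix of the Lawrence–Krammer cell with the denominator `v l (v - v⁻¹)` cleared,
over the polynomials in `v = X 0` and `l = X 1`. -/
noncomputable def lkPolyMatrix (N : ℕ) : Matrix (Fin N) (Fin N) (MvPolynomial (Fin 2) ℚ) :=
  Matrix.of fun j k =>
    if k = j then .X 0 * (.X 1 ^ 2 - 1) + (.X 0 ^ 2 - 1) * .X 1
    else if (k : ℕ) % 2 = j % 2 then (.X 0 ^ 2 - 1) * .X 1
    else if k < j then (.X 0 ^ 2 - 1) * .X 1 ^ 2 else .X 0 ^ 2 - 1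

theorem det_lkPolyMatrix_ne_zero (N : ℕ) : (lkPolyMatrix N).det ≠ 0 := by
  -- At `v = 1` the matrix becomes the scalar matrix `l ^ 2 - 1`.
  have eval_eq : (MvPolynomial.eval ![1, 2]).mapMatrix (lkPolyMatrix N) =
      Matrix.diagonal fun _ => (3 : ℚ) := by
    ext j k
    rcases eq_or_ne k j with rfl | hkj
    · norm_num [lkPolyMatrix]
    · simp only [RingHom.mapMatrix_apply, Matrix.map_apply, lkPolyMatrix, Matrix.of_apply,
        if_neg hkj, Matrix.diagonal_apply_ne _ hkj.symm]
      split_ifs <;> simp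
  intro h
  have eval_det := congrArg (MvPolynomial.eval ![1, 2]) h
  rw [RingHom.map_det, eval_eq, Matrix.det_diagonal, map_zero, Finset.prod_const] at eval_det
  exact pow_ne_zero _ (by norm_num) eval_det

theorem pow_ne_one_of_algebraicIndependent (hvl : AlgebraicIndependent ℚ ![v, l]) {k : ℕ}
    (hk : k ≠ 0) : v ^ k ≠ 1 := by
  intro h
  have relation : (.X 0 ^ k - 1 : MvPolynomial (Fin 2) ℚ) = 0 :=
    hvl (by simp [h])
  have eval_two := congrArg (MvPolynomial.eval ![2, 0]) relation
  rw [map_sub, map_pow, MvPolynomial.eval_X, map_one, map_zero, sub_eq_zero] at eval_two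
  exact (one_lt_pow₀ (one_lt_two (α := ℚ)) hk).ne' eval_two

theorem sub_inv_ne_zero_of_algebraicIndependent (hvl : AlgebraicIndependent ℚ ![v, l]) :
    v - v⁻¹ ≠ 0 := fun h =>
  pow_ne_one_of_algebraicIndependent hvl two_ne_zero <| by
    rw [sq, ← mul_inv_cancel₀ (hvl.ne_zero 0), Matrix.cons_val_zero, ← sub_eq_zero.1 h]

theorem add_inv_ne_zero_of_algebraicIndependent (hvl : AlgebraicIndependent ℚ ![v, l]) :
    v + v⁻¹ ≠ 0 := fun h =>
  pow_ne_one_of_algebraicIndependent hvl four_ne_zero <| by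
    have hv : v ≠ 0 := hvl.ne_zero 0
    have sq_eq : v ^ 2 = -1 := by linear_combination v * h - mul_inv_cancel₀ hv
    linear_combination (v ^ 2 - 1) * sq_eq

theorem det_lkGram_ne_zero (hvl : AlgebraicIndependent ℚ ![v, l]) (N : ℕ) :
    (lkGram N (v - v⁻¹) l).det ≠ 0 := by
  have hv : v ≠ 0 := hvl.ne_zero 0
  have hl : l ≠ 0 := hvl.ne_zero 1
  have hv2 : v ^ 2 - 1 ≠ 0 := sub_ne_zero.2 (pow_ne_one_of_algebraicIndependent hvl two_ne_zero)
  have specialize : (MvPolynomial.aeval ![v, l] : MvPolynomial (Fin 2) ℚ →ₐ[ℚ] F).mapMatrix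
      (lkPolyMatrix N) = (v * l * (v - v⁻¹)) • lkGram N (v - v⁻¹) l := by
    ext j k
    simp only [AlgHom.mapMatrix_apply, Matrix.map_apply, lkPolyMatrix, Matrix.of_apply,
      Matrix.smul_apply, lkGram, lkCoeff, Fin.val_inj, Fin.lt_def, smul_eq_mul]
    split_ifs <;> simp <;> field_simp
  intro h
  refine det_lkPolyMatrix_ne_zero N (hvl ?_)
  rw [AlgHom.map_det, specialize, Matrix.det_smul, h, mul_zero, map_zero]

end Generic

section Lifting

universe u

variable {F : Type*} [Field F] {n : ℕ} {v l : F}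

theorem rev_liftCell {M : Type*} [LinearOrder M] {m : F} (D : M → M → BMW n m l) (S T : M) :
    BMW.rev n m l (liftCell n m l D S T) = liftCell n m l D T S := by
  rcases lt_trichotomy S T with h | rfl | h
  · simp only [liftCell, if_pos h, if_neg h.not_gt]
  · simp only [liftCell, lt_irrefl, if_false, map_smul, map_add, BMW.rev_rev]
    rw [add_comm]
  · simp only [liftCell, if_pos h, if_neg h.not_gt, BMW.rev_rev]

theorem toHecke_liftCell (h2 : (2 : F) ≠ 0) (hv : v ≠ 0) {M : Type*} [LinearOrder M]
    {C : M → M → Hecke n v} (hC : ∀ S T, Hecke.rev n v (C S T) = C T S)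
    {D : M → M → BMW n (v - v⁻¹) l} (hD : ∀ S T, S ≤ T → toHecke n v l hv (D S T) = C S T)
    (S T : M) : toHecke n v l hv (liftCell n (v - v⁻¹) l D S T) = C S T := by
  rcases lt_trichotomy S T with h | rfl | h
  · rw [liftCell, if_pos h, hD S T h.le]
  · rw [liftCell, if_neg (lt_irrefl _), if_neg (lt_irrefl _), map_smul, map_add, toHecke_rev,
      hD S S le_rfl, hC, ← two_smul F, smul_smul, inv_mul_cancel₀ h2, one_smul]
  · rw [liftCell, if_neg h.not_gt, if_pos h, toHecke_rev, hD T S h.le, hC]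

theorem mem_of_toHecke_mem_map (hv : v ≠ 0) (hm : v - v⁻¹ ≠ 0) (hl : l ≠ 0)
    {L : Submodule F (BMW n (v - v⁻¹) l)} (hL : BMW.lkSpan n (v - v⁻¹) l ≤ L)
    {b : BMW n (v - v⁻¹) l} (hb : toHecke n v l hv b ∈ L.map (toHecke n v l hv).toLinearMap) :
    b ∈ L := by
  obtain ⟨c, hc, hcb⟩ := hb
  rw [← sub_add_cancel b c]
  refine L.add_mem (hL (mem_lkSpan_of_toHecke_eq_zero hv hm hl ?_)) hc
  rw [map_sub, sub_eq_zero]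
  exact hcb.symm

variable {Λ : Type u} {M : Λ → Type}

variable (n M) in
/-- The index set of a lifted cell family is the disjoint union of the index set of the extra cell
and that of the given cells. -/
def cellIndexEquiv :
    (Fin (2 * n + 1) × Fin (2 * n + 1)) ⊕ (Σ μ : Λ, M μ × M μ) ≃
      (Σ μ : WithBot Λ, cellIndex n M μ × cellIndex n M μ) where
  toFun := Sum.elim (fun x => ⟨⊥, x⟩) (fun x => ⟨(x.1 : WithBot Λ), x.2⟩)
  invFun x := WithBot.recBotCoe
    (C := fun μ => cellIndex n M μ × cellIndex n M μ →
      (Fin (2 * n + 1) × Fin (2 * n + 1)) ⊕ (Σ μ : Λ, M μ × M μ))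
    (fun x => Sum.inl x) (fun μ x => Sum.inr ⟨μ, x⟩) x.1 x.2
  left_inv := by rintro (x | x) <;> rfl
  right_inv := by
    rintro ⟨μ, x⟩
    induction μ using WithBot.recBotCoe <;> rfl

variable [∀ μ, LinearOrder (M μ)]

theorem cellElement_comp_cellIndexEquiv (m : F) (D : ∀ μ, M μ → M μ → BMW n m l) :
    (fun x : (Σ μ : WithBot Λ, cellIndex n M μ × cellIndex n M μ) =>
        cellElement n m l M D x.1 x.2.1 x.2.2) ∘ cellIndexEquiv n M =
      Sum.elim (fun x => BMW.lkElement n m l x.1 x.2)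
        (fun x => liftCell n m l (D x.1) x.2.1 x.2.2) := by
  ext (x | x) <;> rfl

theorem rev_cellElement (m : F) (D : ∀ μ, M μ → M μ → BMW n m l) (μ : WithBot Λ)
    (S T : cellIndex n M μ) :
    BMW.rev n m l (cellElement n m l M D μ S T) = cellElement n m l M D μ T S := by
  induction μ using WithBot.recBotCoe with
  | bot => exact BMW.rev_lkElement S T
  | coe μ => exact rev_liftCell (D μ) S T

section Lift

variable {C : ∀ μ, M μ → M μ → Hecke n v} {D : ∀ μ, M μ → M μ → BMW n (v - v⁻¹) l}

theorem cellElement_linearIndependent (hv : v ≠ 0) (hm : v - v⁻¹ ≠ 0) (hl : l ≠ 0)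
    (hdet : (lkGram (2 * n + 1) (v - v⁻¹) l).det ≠ 0)
    (hD : ∀ μ S T, toHecke n v l hv (liftCell n (v - v⁻¹) l (D μ) S T) = C μ S T)
    (hC : LinearIndependent F (fun x : (Σ μ : Λ, M μ × M μ) => C x.1 x.2.1 x.2.2)) :
    LinearIndependent F (fun x : (Σ μ : WithBot Λ, cellIndex n M μ × cellIndex n M μ) =>
      cellElement n (v - v⁻¹) l M D x.1 x.2.1 x.2.2) := by
  have lift_indep : LinearIndependent F
      ((toHecke n v l hv).toLinearMap ∘ fun x : (Σ μ : Λ, M μ × M μ) =>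
        liftCell n (v - v⁻¹) l (D x.1) x.2.1 x.2.2) := by
    simpa only [Function.comp_def, AlgHom.toLinearMap_apply, hD] using hC
  have lkSpan_le_ker : BMW.lkSpan n (v - v⁻¹) l ≤ LinearMap.ker (toHecke n v l hv).toLinearMap :=
    Submodule.span_le.2 (Set.range_subset_iff.2 fun x => toHecke_lkElement hv x.1 x.2)
  rw [← linearIndependent_equiv (cellIndexEquiv n M), cellElement_comp_cellIndexEquiv]
  exact (lkElement_linearIndependent hm hl hdet).sum_type (.of_comp _ lift_indep)
    ((Submodule.range_ker_disjoint lift_indep).symm.mono_left lkSpan_le_ker)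

theorem span_cellElement (hv : v ≠ 0) (hm : v - v⁻¹ ≠ 0) (hl : l ≠ 0)
    (hD : ∀ μ S T, toHecke n v l hv (liftCell n (v - v⁻¹) l (D μ) S T) = C μ S T)
    (hC : Submodule.span F
      (Set.range fun x : (Σ μ : Λ, M μ × M μ) => C x.1 x.2.1 x.2.2) = ⊤) :
    Submodule.span F (Set.range
      fun x : (Σ μ : WithBot Λ, cellIndex n M μ × cellIndex n M μ) =>
        cellElement n (v - v⁻¹) l M D x.1 x.2.1 x.2.2) = ⊤ := by
  rw [← (cellIndexEquiv n M).surjective.range_comp, cellElement_comp_cellIndexEquiv,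
    Set.Sum.elim_range, Submodule.span_union, eq_top_iff]
  refine fun b _ => mem_of_toHecke_mem_map hv hm hl le_sup_left ?_
  refine Submodule.map_mono le_sup_right ?_
  simp only [Submodule.map_span, ← Set.range_comp, Function.comp_def, AlgHom.toLinearMap_apply,
    hD, hC, Submodule.mem_top]

theorem cellElement_mul [PartialOrder Λ] [∀ μ, Fintype (M μ)] (hv : v ≠ 0) (hm : v - v⁻¹ ≠ 0)
    (hl : l ≠ 0)
    (hD : ∀ μ S T, toHecke n v l hv (liftCell n (v - v⁻¹) l (D μ) S T) = C μ S T)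
    {a : BMW n (v - v⁻¹) l} {μ : Λ} {r : M μ → M μ → F} (S T : M μ)
    (hr : toHecke n v l hv a * C μ S T - ∑ S', r S' S • C μ S' T ∈
      Submodule.span F {x | ∃ κ : Λ, κ < μ ∧ ∃ P Q : M κ, x = C κ P Q}) :
    a * liftCell n (v - v⁻¹) l (D μ) S T -
        ∑ S', r S' S • liftCell n (v - v⁻¹) l (D μ) S' T ∈
      Submodule.span F {x | ∃ κ : WithBot Λ, κ < μ ∧
        ∃ P Q : cellIndex n M κ, x = cellElement n (v - v⁻¹) l M D κ P Q} := by
  refine mem_of_toHecke_mem_map hv hm hl (Submodule.span_mono ?_) ?_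
  · rintro _ ⟨x, rfl⟩
    exact ⟨⊥, WithBot.bot_lt_coe μ, x.1, x.2, rfl⟩
  simp only [map_sub, map_mul, map_sum, map_smul, hD]
  refine Submodule.span_le.2 ?_ hr
  rintro _ ⟨κ, hκ, P, Q, rfl⟩
  exact ⟨_, Submodule.subset_span ⟨κ, WithBot.coe_lt_coe.2 hκ, P, Q, rfl⟩, hD κ P Q⟩

variable [PartialOrder Λ] [∀ μ, Fintype (M μ)]

theorem toHecke_cellElement (h2 : (2 : F) ≠ 0) (hv : v ≠ 0)
    (hC : IsCellDatum Λ M C (Hecke.rev n v))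
    (hD : ∀ (μ : Λ) (S T : M μ), S ≤ T → toHecke n v l hv (D μ S T) = C μ S T)
    (μ : Λ) (S T : M μ) :
    toHecke n v l hv (cellElement n (v - v⁻¹) l M D (μ : WithBot Λ) S T) = C μ S T :=
  toHecke_liftCell h2 hv (hC.star_C μ) (hD μ) S T

theorem isCellDatum_cellElement (h2 : (2 : F) ≠ 0) (hv : v ≠ 0) (hm : v - v⁻¹ ≠ 0) (hl : l ≠ 0)
    (hdet : (lkGram (2 * n + 1) (v - v⁻¹) l).det ≠ 0)
    (hC : IsCellDatum Λ M C (Hecke.rev n v))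
    (hD : ∀ (μ : Λ) (S T : M μ), S ≤ T → toHecke n v l hv (D μ S T) = C μ S T) :
    IsCellDatum (WithBot Λ) (cellIndex n M) (cellElement n (v - v⁻¹) l M D)
      (BMW.rev n (v - v⁻¹) l) := by
  have hlift : ∀ μ S T, toHecke n v l hv (liftCell n (v - v⁻¹) l (D μ) S T) = C μ S T :=
    toHecke_cellElement h2 hv hC hD
  have indep := cellElement_linearIndependent hv hm hl hdet hlift hC.linearIndependent
  refine ⟨indep.injective, indep, span_cellElement hv hm hl hlift hC.span_eq_top, BMW.rev_mul,
    BMW.rev_rev, rev_cellElement _ D, fun a μ => ?_⟩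
  induction μ using WithBot.recBotCoe with
  | bot =>
    refine ⟨fun i' i => lkRep n hm hl a (lkVec F n i.val) i',
      fun (i j : Fin (2 * n + 1)) => ?_⟩
    convert Submodule.zero_mem _
    exact sub_eq_zero.2 (BMW.mul_lkElement hm hl a i j)
  | coe μ =>
    obtain ⟨r, hr⟩ := hC.mul_C (toHecke n v l hv a) μ
    exact ⟨r, fun S T => cellElement_mul hv hm hl hlift S T (hr S T)⟩

end Lift

end Lifting

open Polynomial

section BraidPolynomial

theorem eq_prod_X_sub_C_of_isMonicOfDegree {F ι : Type*} [Field F] {p : F[X]} {s : Finset ι}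
    {c : ι → F} (hp : IsMonicOfDegree p s.card) (hc : Set.InjOn c s)
    (hroot : ∀ j ∈ s, p.IsRoot (c j)) : p = ∏ j ∈ s, (X - C (c j)) := by
  refine eq_of_monic_of_dvd_of_natDegree_le (monic_prod_X_sub_C c s) hp.monic ?_ ?_
  · refine Finset.prod_dvd_of_coprime (fun i hi j hj hij => ?_)
      fun j hj => dvd_iff_isRoot.2 (hroot j hj)
    exact isCoprime_X_sub_C_of_isUnit_sub (sub_ne_zero.2 (hc.ne hi hj hij)).isUnit
  · rw [hp.natDegree_eq, natDegree_finsetProd_X_sub_C_eq_card]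

variable (F : Type*) [Field F]

/-- The polynomial `Q_k` determined by `Q_k(2 + q + q⁻¹) = q^(-k) + ⋯ + q^k`. In the generators
`b_i = x_i + v`, the braid relation of length `2k + 1` says that `Q_k`, evaluated at a central
element, kills `b_0 - b_1`. -/
noncomputable def braidPoly : ℕ → F[X]
  | 0 => 1
  | 1 => X - 1
  | k + 2 => (X - 2) * braidPoly (k + 1) - braidPoly k

theorem isMonicOfDegree_braidPoly (k : ℕ) : IsMonicOfDegree (braidPoly F k) k := by
  induction k using Nat.twoStepInduction with
  | zero => exact isMonicOfDegree_zero_iff.2 rfl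
  | one => simpa [braidPoly] using isMonicOfDegree_X_sub_one (1 : F)
  | more k ih ih' =>
    have leading : IsMonicOfDegree ((X - 2) * braidPoly F (k + 1)) (k + 2) :=
      add_comm 1 (k + 1) ▸ (isMonicOfDegree_X_sub_one 2).mul ih'
    exact leading.sub (by rw [ih.natDegree_eq]; omega)

variable {F}

theorem eval_braidPoly {q : F} (hq : q ≠ 0) (k : ℕ) :
    (q - 1) * (q ^ k * (braidPoly F k).eval (2 + q + q⁻¹)) = q ^ (2 * k + 1) - 1 := by
  induction k using Nat.twoStepInduction with
  | zero => simp [braidPoly]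
  | one =>
    simp only [braidPoly, eval_sub, eval_X, eval_one]
    field_simp
    ring
  | more k ih ih' =>
    have recurrence : (q - 1) * (q ^ (k + 2) * (braidPoly F (k + 2)).eval (2 + q + q⁻¹)) =
        (q ^ 2 + 1) * ((q - 1) * (q ^ (k + 1) * (braidPoly F (k + 1)).eval (2 + q + q⁻¹))) -
          q ^ 2 * ((q - 1) * (q ^ k * (braidPoly F k).eval (2 + q + q⁻¹))) := by
      simp only [braidPoly, eval_sub, eval_mul, eval_X, eval_ofNat]
      field_simp
      ring
    rw [recurrence, ih, ih']
    ring

theorem braidPoly_map {K : Type*} [Field K] (f : F →+* K) (k : ℕ) :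
    (braidPoly F k).map f = braidPoly K k := by
  induction k using Nat.twoStepInduction with
  | zero => simp [braidPoly]
  | one => simp [braidPoly]
  | more k ih ih' => simp [braidPoly, ih, ih']

end BraidPolynomial

section QuadraticPair

variable {F A : Type*} [Field F] [Ring A] [Algebra F A]

/-- For `a² = δ a` and `b² = δ b`, this element commutes with `a` and `b`. -/
def pairCasimir (δ : F) (a b : A) : A := a * b + b * a - δ • (a + b) + δ ^ 2 • 1

variable {δ : F} {a b : A}

theorem pairCasimir_comm : pairCasimir δ a b = pairCasimir δ b a := by
  rw [pairCasimir, pairCasimir, add_comm (a * b), add_comm a b]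

theorem pairCasimir_mul_left (ha : a * a = δ • a) : pairCasimir δ a b * a = a * b * a := by
  simp only [pairCasimir, add_mul, sub_mul, smul_mul_assoc, mul_assoc, ha, one_mul, mul_smul_comm]
  module

theorem mul_pairCasimir_left (ha : a * a = δ • a) : a * pairCasimir δ a b = a * b * a := by
  simp only [pairCasimir, mul_add, mul_sub, mul_smul_comm, ← mul_assoc, ha, mul_one,
    smul_mul_assoc]
  module

theorem commute_pairCasimir_left (ha : a * a = δ • a) : Commute (pairCasimir δ a b) a :=
  (pairCasimir_mul_left ha).trans (mul_pairCasimir_left ha).symm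

theorem commute_pairCasimir_right (hb : b * b = δ • b) : Commute (pairCasimir δ a b) b :=
  pairCasimir_comm (δ := δ) (a := a) (b := b) ▸ commute_pairCasimir_left hb

theorem mul_mul_mul_add_one_of_mul_self {x y : A} {m : F} (hx : x * x = 1 - m • x)
    (hy : y * y = 1 - m • y) :
    x * y * (x * y) + 1 = (x * y + y * x + m • (x + y) + m ^ 2 • 1) * (x * y) := by
  have hxx (z : A) : x * (x * z) = z - m • (x * z) := by
    rw [← mul_assoc, hx, sub_mul, one_mul, smul_mul_assoc]
  simp only [add_mul, smul_mul_assoc, mul_assoc, hxx, hy, mul_sub, mul_smul_comm, one_mul]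
  module

section Shift

variable {v : F}

theorem sub_smul_one_mul_self (hv : v ≠ 0) (ha : a * a = (v + v⁻¹) • a) :
    (a - v • 1) * (a - v • 1) = 1 - (v - v⁻¹) • (a - v • 1) := by
  have cancel : v⁻¹ * v = 1 := inv_mul_cancel₀ hv
  simp only [sub_mul, mul_sub, ha, smul_mul_assoc, mul_smul_comm, one_mul, mul_one]
  linear_combination (norm := module) cancel • (1 : A)

theorem pairCasimir_sub_two (hv : v ≠ 0) :
    pairCasimir (v + v⁻¹) a b - 2 =
      (a - v • 1) * (b - v • 1) + (b - v • 1) * (a - v • 1) +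
        (v - v⁻¹) • ((a - v • 1) + (b - v • 1)) + (v - v⁻¹) ^ 2 • 1 := by
  have cancel : v⁻¹ * v = 1 := inv_mul_cancel₀ hv
  simp only [pairCasimir, sub_mul, mul_sub, smul_mul_assoc, mul_smul_comm, one_mul, mul_one,
    ← one_add_one_eq_two]
  linear_combination (norm := module) (2 * cancel) • (1 : A)

theorem altL_add_four (hv : v ≠ 0) (ha : a * a = (v + v⁻¹) • a) (hb : b * b = (v + v⁻¹) • b)
    (N : ℕ) : altL (a - v • 1) (b - v • 1) (N + 4) =
      (pairCasimir (v + v⁻¹) a b - 2) * altL (a - v • 1) (b - v • 1) (N + 2) -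
        altL (a - v • 1) (b - v • 1) N := by
  have square := mul_mul_mul_add_one_of_mul_self (sub_smul_one_mul_self hv ha)
    (sub_smul_one_mul_self hv hb)
  rw [← pairCasimir_sub_two hv] at square
  have altL_add_two (x y : A) (k : ℕ) : altL x y (k + 2) = x * y * altL x y k :=
    (mul_assoc x y _).symm
  rw [altL_add_two _ _ (N + 2), altL_add_two _ _ N, ← mul_assoc (_ * _), ← mul_assoc _ (_ * _),
    eq_sub_of_add_eq square, sub_mul, one_mul]

theorem altL_sub_altL (hv : v ≠ 0) (ha : a * a = (v + v⁻¹) • a)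
    (hb : b * b = (v + v⁻¹) • b) (k : ℕ) :
    altL (a - v • 1) (b - v • 1) (2 * k + 1) - altL (b - v • 1) (a - v • 1) (2 * k + 1) =
      aeval (pairCasimir (v + v⁻¹) a b) (braidPoly F k) * (a - b) := by
  induction k using Nat.twoStepInduction with
  | zero => simp [altL, braidPoly]
  | one =>
    have cancel : v * v⁻¹ = 1 := mul_inv_cancel₀ hv
    rw [braidPoly, map_sub, aeval_X, map_one, sub_mul, mul_sub, one_mul,
      pairCasimir_mul_left ha, pairCasimir_comm, pairCasimir_mul_left hb]
    simp only [altL, mul_one, sub_mul, mul_sub, smul_mul_assoc, mul_smul_comm, one_mul, smul_sub,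
      ha, hb, mul_assoc]
    linear_combination (norm := module) cancel • (b - a)
  | more k ih ih' =>
    have two_eq : aeval (pairCasimir (v + v⁻¹) a b) (2 : F[X]) = 2 := map_ofNat _ 2
    rw [show 2 * (k + 2) + 1 = 2 * k + 1 + 4 by ring, altL_add_four hv ha hb,
      altL_add_four hv hb ha, pairCasimir_comm (a := b), braidPoly, map_sub, map_mul, map_sub,
      aeval_X, two_eq, sub_mul _ _ (a - b), ← ih, mul_assoc, ← ih',
      show 2 * (k + 1) + 1 = 2 * k + 1 + 2 by ring, mul_sub]
    abel

end Shift

end QuadraticPair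

section CellAction

variable {R A : Type*} [CommRing R] [Ring A] [Algebra R A] {Λ : Type*} {M : Λ → Type*}

variable (R) in
/-- The span of the elements of a family `C` that lie in the cells of `s`. -/
def cellSpan (C : ∀ μ, M μ → M μ → A) (s : Set Λ) : Submodule R A :=
  Submodule.span R {x | ∃ κ ∈ s, ∃ P Q : M κ, x = C κ P Q}

variable {C : ∀ μ, M μ → M μ → A}

theorem mem_cellSpan {s : Set Λ} {μ : Λ} (hμ : μ ∈ s) (S T : M μ) : C μ S T ∈ cellSpan R C s :=
  Submodule.subset_span ⟨μ, hμ, S, T, rfl⟩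

theorem cellSpan_mono {s t : Set Λ} (hst : s ⊆ t) : cellSpan R C s ≤ cellSpan R C t :=
  Submodule.span_mono fun _ ⟨μ, hμ, S, T, hx⟩ => ⟨μ, hst hμ, S, T, hx⟩

theorem cellSpan_univ : cellSpan R C Set.univ =
    Submodule.span R (Set.range fun x : (Σ μ : Λ, M μ × M μ) => C x.1 x.2.1 x.2.2) := by
  refine congrArg (Submodule.span R) (Set.ext fun x => ⟨?_, ?_⟩)
  · rintro ⟨μ, -, S, T, rfl⟩
    exact ⟨⟨μ, S, T⟩, rfl⟩
  · rintro ⟨⟨μ, S, T⟩, rfl⟩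
    exact ⟨μ, trivial, S, T, rfl⟩

variable [PartialOrder Λ] [∀ μ, Fintype (M μ)]

variable (R) in
/-- The multiplication axiom (C3) of a cell datum, for one element `a` of the algebra. -/
def ActsOnCells (C : ∀ μ, M μ → M μ → A) (a : A) : Prop :=
  ∀ μ, ∃ r : M μ → M μ → R, ∀ S T : M μ,
    a * C μ S T - ∑ S' : M μ, r S' S • C μ S' T ∈ cellSpan R C (Set.Iio μ)

theorem actsOnCells_algebraMap (c : R) : ActsOnCells R C (algebraMap R A c) := by
  classical
  refine fun μ => ⟨fun S' S => if S' = S then c else 0, fun S T => ?_⟩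
  simp [← Algebra.smul_def, ite_smul]

namespace ActsOnCells

variable {a b : A}

protected theorem add (ha : ActsOnCells R C a) (hb : ActsOnCells R C b) :
    ActsOnCells R C (a + b) := by
  intro μ
  obtain ⟨r, hr⟩ := ha μ
  obtain ⟨s, hs⟩ := hb μ
  refine ⟨r + s, fun S T => ?_⟩
  simp only [Pi.add_apply, add_smul, Finset.sum_add_distrib, add_mul, add_sub_add_comm]
  exact add_mem (hr S T) (hs S T)

theorem mul_mem_cellSpan (ha : ActsOnCells R C a) {s : Set Λ} (hs : IsLowerSet s) {x : A}
    (hx : x ∈ cellSpan R C s) : a * x ∈ cellSpan R C s := by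
  induction hx using Submodule.span_induction with
  | zero => exact (mul_zero a).symm ▸ zero_mem _
  | add x y _ _ hx hy => exact mul_add a x y ▸ add_mem hx hy
  | smul c x _ hx => exact mul_smul_comm c a x ▸ Submodule.smul_mem _ c hx
  | mem x hx =>
    obtain ⟨κ, hκ, P, Q, rfl⟩ := hx
    obtain ⟨r, hr⟩ := ha κ
    rw [← sub_add_cancel (a * C κ P Q) (∑ S' : M κ, r S' P • C κ S' Q)]
    exact add_mem (cellSpan_mono (fun κ' hκ' => hs (le_of_lt hκ') hκ) (hr P Q))
      (sum_mem fun S' _ => Submodule.smul_mem _ _ (mem_cellSpan hκ S' Q))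

protected theorem mul (ha : ActsOnCells R C a) (hb : ActsOnCells R C b) :
    ActsOnCells R C (a * b) := by
  intro μ
  obtain ⟨r, hr⟩ := ha μ
  obtain ⟨s, hs⟩ := hb μ
  refine ⟨fun S' S => ∑ S'', s S'' S * r S' S'', fun S T => ?_⟩
  have split : a * b * C μ S T - ∑ S', (∑ S'', s S'' S * r S' S'') • C μ S' T =
      a * (b * C μ S T - ∑ S'', s S'' S • C μ S'' T) +
        ∑ S'', s S'' S • (a * C μ S'' T - ∑ S', r S' S'' • C μ S' T) := by
    simp only [mul_sub, Finset.mul_sum, mul_smul_comm, smul_sub, Finset.sum_sub_distrib,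
      sub_add_sub_cancel, mul_assoc, Finset.sum_smul, Finset.smul_sum, smul_smul]
    rw [Finset.sum_comm]
  rw [split]
  exact add_mem (ha.mul_mem_cellSpan (isLowerSet_Iio μ) (hs S T))
    (sum_mem fun S'' _ => Submodule.smul_mem _ _ (hr S'' T))

end ActsOnCells

end CellAction

section CellSeparation

variable {F A W : Type*} [Field F] [AddCommGroup A] [Module F A] [AddCommGroup W] [Module F W]
  {Λ : Type*} {M : Λ → Type*} [∀ μ, Finite (M μ)] {C : ∀ μ, M μ → M μ → A}

/-- The linear map `φ` kills the cells below `μ` and keeps the elements of the cell `μ`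
independent; independence of the whole family follows when every cell has such a map. -/
def SeparatesCell [Preorder Λ] (C : ∀ μ, M μ → M μ → A) (φ : A →ₗ[F] W) (μ : Λ) : Prop :=
  (∀ κ < μ, ∀ S T, φ (C κ S T) = 0) ∧
    LinearIndependent F fun x : M μ × M μ => φ (C μ x.1 x.2)

theorem linearIndependent_of_separatesCell [LinearOrder Λ] [Finite Λ]
    (h : ∀ μ, ∃ φ : A →ₗ[F] W, SeparatesCell C φ μ) :
    LinearIndependent F fun x : (Σ μ, M μ × M μ) => C x.1 x.2.1 x.2.2 := by
  have := Fintype.ofFinite Λ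
  have := fun μ => Fintype.ofFinite (M μ)
  choose φ below independent using h
  refine Fintype.linearIndependent_iff.2 fun g hg ⟨μ, x⟩ => ?_
  induction μ using WellFoundedGT.induction with
  | ind μ ih =>
    refine Fintype.linearIndependent_iff.1 (independent μ) (fun x => g ⟨μ, x⟩) ?_ x
    have image := congrArg (φ μ) hg
    rw [map_sum, Fintype.sum_sigma, map_zero, Fintype.sum_eq_single μ] at image
    · simpa only [map_smul] using image
    · intro κ hκ
      refine Finset.sum_eq_zero fun y _ => ?_
      rcases hκ.lt_or_gt with hlt | hgt
      · rw [map_smul, below μ κ hlt, smul_zero]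
      · rw [ih κ hgt, zero_smul, map_zero]

end CellSeparation

section DihedralCells

/-- The cells of the dihedral Hecke algebra of order `2(2n + 1)`: a greatest one `⊤`, a least one
`⊥`, and between them a chain of `n` cells, of which the one numbered `0` is the highest. -/
abbrev DihedralCell (n : ℕ) : Type := WithBot (WithTop (Fin n)ᵒᵈ)

/-- The intermediate cell with number `k`. -/
abbrev DihedralCell.middle {n : ℕ} (k : Fin n) : DihedralCell n :=
  WithBot.some (WithTop.some (OrderDual.toDual k))

/-- The size of the index set of a cell. -/
def DihedralCell.size {n : ℕ} : DihedralCell n → ℕ :=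
  WithBot.recBotCoe 1 (WithTop.recTopCoe 1 fun _ => 2)

@[elab_as_elim]
theorem DihedralCell.cases {n : ℕ} {P : DihedralCell n → Prop} (bot : P ⊥) (top : P ⊤)
    (middle : ∀ k, P (middle k)) (μ : DihedralCell n) : P μ := by
  induction μ using WithBot.recBotCoe with
  | bot => exact bot
  | coe μ =>
    induction μ using WithTop.recTopCoe with
    | top => exact top
    | coe k => exact middle (OrderDual.ofDual k)

variable {F A : Type*} [Field F] [Ring A] [Algebra F A]

/-- The product of the first `k` factors `t - c_j`, where `t` is `pairCasimir δ a b`. -/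
noncomputable def casimirProd (δ : F) (c : ℕ → F) (a b : A) (k : ℕ) : A :=
  aeval (pairCasimir δ a b) (∏ j ∈ Finset.range k, (X - C (c j)))

/-- The cell basis built from two quasi-idempotents `a` and `b`: the unit in the cell `⊤`, the four
multiples of `a`, `a b`, `b a`, `b a b` by a product of factors `t - c_j` in the other cells, except
that the full product, which does not distinguish `a` from `b`, leaves a single element in `⊥`. -/
noncomputable def pairCell (n : ℕ) (δ : F) (c : ℕ → F) (a b : A) :
    ∀ μ : DihedralCell n, Fin μ.size → Fin μ.size → A :=
  WithBot.recBotCoe (fun _ _ => casimirProd δ c a b n * a) <|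
    WithTop.recTopCoe (fun _ _ => 1) fun k (S T : Fin 2) =>
      casimirProd δ c a b (OrderDual.ofDual k : Fin n) * (![1, b] S * a * ![1, b] T)

variable {n : ℕ} {δ : F} {c : ℕ → F} {a b : A}

section CasimirProd

theorem casimirProd_zero : casimirProd δ c a b 0 = 1 := by
  rw [casimirProd, Finset.prod_range_zero, map_one]

theorem casimirProd_succ (k : ℕ) : casimirProd δ c a b (k + 1) =
    casimirProd δ c a b k * (pairCasimir δ a b - c k • 1) := by
  rw [casimirProd, Finset.prod_range_succ, map_mul, map_sub, aeval_X, aeval_C,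
    Algebra.algebraMap_eq_smul_one, casimirProd]

theorem casimirProd_comm (k : ℕ) : casimirProd δ c a b k = casimirProd δ c b a k := by
  rw [casimirProd, casimirProd, pairCasimir_comm]

theorem commute_casimirProd {x : A} (hx : Commute (pairCasimir δ a b) x) (k : ℕ) :
    Commute (casimirProd δ c a b k) x := by
  induction k with
  | zero => exact casimirProd_zero (δ := δ) (c := c) (a := a) (b := b) ▸ Commute.one_left x
  | succ k ih =>
    rw [casimirProd_succ]
    exact ih.mul_left (hx.sub_left ((Commute.one_left x).smul_left (c k)))

theorem commute_casimirProd_left (ha : a * a = δ • a) (k : ℕ) :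
    Commute (casimirProd δ c a b k) a :=
  commute_casimirProd (commute_pairCasimir_left ha) k

theorem commute_casimirProd_right (hb : b * b = δ • b) (k : ℕ) :
    Commute (casimirProd δ c a b k) b :=
  commute_casimirProd (commute_pairCasimir_right hb) k

theorem casimirProd_mul_mul_mul_left (ha : a * a = δ • a) (k : ℕ) :
    casimirProd δ c a b k * (a * b * a) =
      casimirProd δ c a b (k + 1) * a + c k • (casimirProd δ c a b k * a) := by
  rw [casimirProd_succ, mul_assoc (casimirProd δ c a b k), sub_mul, pairCasimir_mul_left ha,
    smul_mul_assoc, one_mul, mul_sub, mul_smul_comm, sub_add_cancel]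

theorem casimirProd_mul_mul_mul_right (hb : b * b = δ • b) (k : ℕ) :
    casimirProd δ c a b k * (b * a * b) =
      casimirProd δ c a b (k + 1) * b + c k • (casimirProd δ c a b k * b) := by
  simpa only [casimirProd_comm (a := a)] using casimirProd_mul_mul_mul_left hb k

theorem casimirProd_eq_algebraMap {γ : F} (h : pairCasimir δ a b = algebraMap F A γ) (k : ℕ) :
    casimirProd δ c a b k = algebraMap F A (∏ j ∈ Finset.range k, (γ - c j)) := by
  simp only [casimirProd, h, aeval_algebraMap_apply, coe_aeval_eq_eval, eval_prod, eval_sub, eval_X,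
    eval_C]

variable {B : Type*} [Ring B] [Algebra F B] (f : A →ₐ[F] B)

theorem map_pairCasimir : f (pairCasimir δ a b) = pairCasimir δ (f a) (f b) := by
  simp only [pairCasimir, map_add, map_sub, map_mul, map_smul, map_one]

theorem map_casimirProd (k : ℕ) :
    f (casimirProd δ c a b k) = casimirProd δ c (f a) (f b) k := by
  rw [casimirProd, ← aeval_algHom_apply, map_pairCasimir, casimirProd]

theorem map_pairCell (μ : DihedralCell n) (S T : Fin μ.size) :
    f (pairCell n δ c a b μ S T) = pairCell n δ c (f a) (f b) μ S T := by
  induction μ using DihedralCell.cases with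
  | bot => exact (map_mul f _ _).trans (map_casimirProd f n ▸ rfl)
  | top => exact map_one f
  | middle k =>
    have map_word (i : Fin 2) : f (![1, b] i) = ![1, f b] i := by fin_cases i <;> simp
    have map_middle (S T : Fin 2) : f (casimirProd δ c a b k * (![1, b] S * a * ![1, b] T)) =
        casimirProd δ c (f a) (f b) k * (![1, f b] S * f a * ![1, f b] T) := by
      simp only [map_mul, map_casimirProd, map_word]
    exact map_middle S T

end CasimirProd

section Action

variable {s : Set (DihedralCell n)}

theorem casimirProd_mul_mem_of_middle_mem {k : Fin n} (hk : DihedralCell.middle k ∈ s)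
    (S T : Fin 2) : casimirProd δ c a b k * (![1, b] S * a * ![1, b] T) ∈
      cellSpan F (pairCell n δ c a b) s :=
  mem_cellSpan (C := pairCell n δ c a b) hk S T

theorem casimirProd_mul_left_mem (hbot : ⊥ ∈ s) {k : ℕ} (hk : k ≤ n)
    (hs : ∀ j : Fin n, k ≤ j → DihedralCell.middle j ∈ s) :
    casimirProd δ c a b k * a ∈ cellSpan F (pairCell n δ c a b) s := by
  rcases hk.eq_or_lt with rfl | hk
  · exact mem_cellSpan hbot (0 : Fin 1) (0 : Fin 1)
  · simpa using
      casimirProd_mul_mem_of_middle_mem (δ := δ) (c := c) (a := a) (b := b) (hs ⟨k, hk⟩ le_rfl) 0 0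

theorem casimirProd_mul_left_mul_right_mem (hb : b * b = δ • b)
    (hab : casimirProd δ c a b n * a = casimirProd δ c a b n * b) (hbot : ⊥ ∈ s)
    {k : ℕ} (hk : k ≤ n) (hs : ∀ j : Fin n, k ≤ j → DihedralCell.middle j ∈ s) :
    casimirProd δ c a b k * (a * b) ∈ cellSpan F (pairCell n δ c a b) s := by
  rcases hk.eq_or_lt with rfl | hlt
  · rw [← mul_assoc, hab, mul_assoc, hb, mul_smul_comm, ← hab]
    exact Submodule.smul_mem _ _ (casimirProd_mul_left_mem hbot le_rfl hs)
  · simpa using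
      casimirProd_mul_mem_of_middle_mem (δ := δ) (c := c) (a := a) (b := b) (hs ⟨k, hlt⟩ le_rfl) 0 1

theorem casimirProd_mul_right_mem (hb : b * b = δ • b) (hc : ∀ j < n, c j ≠ 0)
    (hab : casimirProd δ c a b n * a = casimirProd δ c a b n * b) (hbot : ⊥ ∈ s)
    {k : ℕ} (hk : k ≤ n) (hs : ∀ j : Fin n, k ≤ j → DihedralCell.middle j ∈ s) :
    casimirProd δ c a b k * b ∈ cellSpan F (pairCell n δ c a b) s := by
  induction hk using Nat.decreasingInduction with
  | self => exact hab ▸ casimirProd_mul_left_mem hbot le_rfl hs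
  | of_succ k hk ih =>
    have cell_mem : casimirProd δ c a b k * (b * a * b) ∈ cellSpan F (pairCell n δ c a b) s :=
      casimirProd_mul_mem_of_middle_mem (hs ⟨k, hk⟩ le_rfl) 1 1
    have solve := eq_sub_of_add_eq' (casimirProd_mul_mul_mul_right (c := c) (a := a) hb k).symm
    rw [← inv_smul_smul₀ (hc k hk) (casimirProd δ c a b k * b), solve]
    exact Submodule.smul_mem _ _ (sub_mem cell_mem (ih fun j hj => hs j (by omega)))

theorem DihedralCell.bot_lt_top : (⊥ : DihedralCell n) < ⊤ := WithBot.bot_lt_coe _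

theorem DihedralCell.middle_lt_top (k : Fin n) : middle k < ⊤ :=
  WithBot.coe_lt_coe.2 (WithTop.coe_lt_top _)

theorem DihedralCell.bot_lt_middle (k : Fin n) : ⊥ < middle k := WithBot.bot_lt_coe _

theorem DihedralCell.middle_lt_middle {j k : Fin n} : middle j < middle k ↔ k < j :=
  WithBot.coe_lt_coe.trans (WithTop.coe_lt_coe.trans OrderDual.toDual_lt_toDual)

theorem actsOnCells_pairCell {x : A}
    (top : x ∈ cellSpan F (pairCell n δ c a b) (Set.Iio ⊤))
    (bot : x * (casimirProd δ c a b n * a) = δ • (casimirProd δ c a b n * a))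
    (middle : ∀ k : Fin n, ∃ r : Matrix (Fin 2) (Fin 2) F, ∀ S T,
      x * (casimirProd δ c a b k * (![1, b] S * a * ![1, b] T)) -
          ∑ S', r S' S • (casimirProd δ c a b k * (![1, b] S' * a * ![1, b] T)) ∈
        cellSpan F (pairCell n δ c a b) (Set.Iio (DihedralCell.middle k))) :
    ActsOnCells F (pairCell n δ c a b) x := by
  intro μ
  induction μ using DihedralCell.cases with
  | bot =>
    refine ⟨fun _ _ => δ, fun _ _ => ?_⟩
    change x * (casimirProd δ c a b n * a) - ∑ _ : Fin 1, δ • (casimirProd δ c a b n * a) ∈ _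
    rw [Fin.sum_const, one_smul, bot, sub_self]
    exact zero_mem _
  | top =>
    refine ⟨0, fun _ _ => ?_⟩
    change x * 1 - ∑ _ : Fin 1, (0 : F) • (1 : A) ∈ _
    rwa [Fin.sum_const, zero_smul, smul_zero, sub_zero, mul_one]
  | middle k => exact middle k

theorem actsOnCells_pairCell_left (ha : a * a = δ • a) (hb : b * b = δ • b)
    (hab : casimirProd δ c a b n * a = casimirProd δ c a b n * b) :
    ActsOnCells F (pairCell n δ c a b) a := by
  have left_comm (k : ℕ) (z : A) :
      a * (casimirProd δ c a b k * z) = casimirProd δ c a b k * (a * z) :=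
    (commute_casimirProd_left ha k).symm.left_comm z
  refine actsOnCells_pairCell ?_ (by rw [left_comm, ha, mul_smul_comm])
    fun k => ⟨!![δ, c k; 0, 0], fun S T => ?_⟩
  · simpa only [casimirProd_zero, one_mul] using casimirProd_mul_left_mem (c := c)
      (a := a) (b := b) DihedralCell.bot_lt_top n.zero_le fun j _ => DihedralCell.middle_lt_top j
  fin_cases S
  · convert Submodule.zero_mem _
    simp [left_comm, ← mul_assoc, ha]
  have remainder (w : A) : a * (casimirProd δ c a b k * (b * a * w)) -
      c k • (casimirProd δ c a b k * (a * w)) = casimirProd δ c a b (k + 1) * (a * w) := by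
    rw [left_comm, ← mul_assoc a, ← mul_assoc a, ← mul_assoc, casimirProd_mul_mul_mul_left ha]
    simp only [add_mul, smul_mul_assoc, mul_assoc, add_sub_cancel_right]
  have lower (j : Fin n) (hj : (k : ℕ) + 1 ≤ j) :
      DihedralCell.middle j ∈ Set.Iio (DihedralCell.middle k) :=
    DihedralCell.middle_lt_middle.2 hj
  suffices h : casimirProd δ c a b (k + 1) * (a * ![1, b] T) ∈
      cellSpan F (pairCell n δ c a b) (Set.Iio (DihedralCell.middle k)) by
    simpa [remainder] using h
  fin_cases T
  · simpa using casimirProd_mul_left_mem (c := c) (a := a) (b := b)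
      (DihedralCell.bot_lt_middle k) k.2 lower
  · exact casimirProd_mul_left_mul_right_mem hb hab (DihedralCell.bot_lt_middle k) k.2 lower

theorem actsOnCells_pairCell_right (hb : b * b = δ • b) (hc : ∀ j < n, c j ≠ 0)
    (hab : casimirProd δ c a b n * a = casimirProd δ c a b n * b) :
    ActsOnCells F (pairCell n δ c a b) b := by
  have left_comm (k : ℕ) (z : A) :
      b * (casimirProd δ c a b k * z) = casimirProd δ c a b k * (b * z) :=
    (commute_casimirProd_right hb k).symm.left_comm z
  refine actsOnCells_pairCell ?_ (by rw [hab, left_comm, hb, mul_smul_comm])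
    fun k => ⟨!![0, 0; 1, δ], fun S T => ?_⟩
  · simpa only [casimirProd_zero, one_mul] using casimirProd_mul_right_mem (c := c) hb hc hab
      DihedralCell.bot_lt_top n.zero_le fun j _ => DihedralCell.middle_lt_top j
  convert Submodule.zero_mem _
  fin_cases S
  · simp [left_comm, mul_assoc]
  · simp [left_comm, ← mul_assoc, hb]

end Action

end DihedralCells

section QuadraticPairRepresentations

variable {F A : Type*} [Field F] [Ring A] [Algebra F A]

theorem pairCasimir_smul_one (δ : F) :
    pairCasimir δ (δ • (1 : A)) (δ • 1) = algebraMap F A (δ ^ 2) := by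
  simp only [pairCasimir, Algebra.algebraMap_eq_smul_one, mul_smul_comm, mul_one]
  module

/-- The matrix by which `a` acts on the intermediate cell of the root `γ` of the braid
polynomial. -/
def cellMatrixLeft (δ γ : F) : Matrix (Fin 2) (Fin 2) F := !![δ, γ; 0, 0]

/-- The matrix by which `b` acts on an intermediate cell. -/
def cellMatrixRight (δ : F) : Matrix (Fin 2) (Fin 2) F := !![0, 0; 1, δ]

theorem cellMatrixLeft_mul_self (δ γ : F) :
    cellMatrixLeft δ γ * cellMatrixLeft δ γ = δ • cellMatrixLeft δ γ := by
  ext i j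
  fin_cases i <;> fin_cases j <;> simp [cellMatrixLeft]

theorem cellMatrixRight_mul_self (δ : F) :
    cellMatrixRight δ * cellMatrixRight δ = δ • cellMatrixRight δ := by
  ext i j
  fin_cases i <;> fin_cases j <;> simp [cellMatrixRight]

theorem pairCasimir_cellMatrix (δ γ : F) :
    pairCasimir δ (cellMatrixLeft δ γ) (cellMatrixRight δ) = algebraMap F _ γ := by
  rw [Algebra.algebraMap_eq_smul_one, Matrix.one_fin_two]
  ext i j
  fin_cases i <;> fin_cases j <;> simp [cellMatrixLeft, cellMatrixRight, pairCasimir] <;> ring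

theorem linearIndependent_cellMatrix {δ γ : F} (hγ : γ ≠ 0) (hδ : δ ^ 2 ≠ γ) :
    LinearIndependent F fun x : Fin 2 × Fin 2 => ![1, cellMatrixRight δ] x.1 *
      cellMatrixLeft δ γ * ![1, cellMatrixRight δ] x.2 := by
  refine Fintype.linearIndependent_iff.2 fun g hg => ?_
  have expand : ∑ x : Fin 2 × Fin 2, g x • (![1, cellMatrixRight δ] x.1 * cellMatrixLeft δ γ *
      ![1, cellMatrixRight δ] x.2) =
        Matrix.of fun i => ![g (i, 0) * δ + g (i, 1) * γ, g (i, 0) * γ + g (i, 1) * (γ * δ)] := by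
    ext i j
    rw [Fintype.sum_prod_type]
    fin_cases i <;> fin_cases j <;> simp [cellMatrixLeft, cellMatrixRight]
  have row (x y : F) (h : x * δ + y * γ = 0) (h' : x * γ + y * (γ * δ) = 0) : x = 0 ∧ y = 0 := by
    have hx : x = -(y * δ) := mul_right_cancel₀ hγ (by linear_combination h')
    have hy : y * (δ ^ 2 - γ) = 0 := by rw [hx] at h; linear_combination -h
    have hy := (mul_eq_zero.1 hy).resolve_right (sub_ne_zero.2 hδ)
    exact ⟨by rw [hx, hy, zero_mul, neg_zero], hy⟩
  rintro ⟨i, j⟩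
  have hrow := congrFun (expand.symm.trans hg) i
  obtain ⟨h₀, h₁⟩ := row _ _ (congrFun hrow 0) (congrFun hrow 1)
  fin_cases j
  exacts [h₀, h₁]

theorem linearIndependent_pairCell_cellMatrix {n : ℕ} {c : ℕ → F} {δ : F} {k : Fin n}
    (hc : c k ≠ 0) (hδ : δ ^ 2 ≠ c k) (hne : ∀ j < (k : ℕ), c j ≠ c k) :
    LinearIndependent F fun x : Fin (DihedralCell.middle k).size ×
        Fin (DihedralCell.middle k).size =>
      pairCell n δ c (cellMatrixLeft δ (c k)) (cellMatrixRight δ) (.middle k) x.1 x.2 := by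
  change LinearIndependent F fun x : Fin 2 × Fin 2 => _
  have factors_ne_zero : ∏ j ∈ Finset.range k, (c k - c j) ≠ 0 :=
    Finset.prod_ne_zero_iff.2 fun j hj => sub_ne_zero.2 (hne j (Finset.mem_range.1 hj)).symm
  convert (linearIndependent_cellMatrix hc hδ).units_smul fun _ => Units.mk0 _ factors_ne_zero
    using 2 with x
  refine (congrArg (· * _) (casimirProd_eq_algebraMap (pairCasimir_cellMatrix δ (c k)) k)).trans ?_
  exact (Algebra.smul_def _ _).symm

end QuadraticPairRepresentations

section KazhdanLusztigGenerators

variable {F : Type*} [Field F] {n : ℕ} {v : F}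

/-- The Kazhdan–Lusztig generators `x_i + v` of the dihedral Hecke algebra. -/
noncomputable def Hecke.klGen (n : ℕ) (v : F) (i : Fin 2) : Hecke n v := Hecke.x n v i + v • 1

theorem Hecke.x_eq_klGen_sub (i : Fin 2) : Hecke.x n v i = Hecke.klGen n v i - v • 1 :=
  (add_sub_cancel_right _ _).symm

theorem Hecke.klGen_mul_self (i : Fin 2) :
    Hecke.klGen n v i * Hecke.klGen n v i = (v + v⁻¹) • Hecke.klGen n v i := by
  have quadratic := Hecke.x_quadratic n v i
  rw [Algebra.algebraMap_eq_smul_one, Algebra.algebraMap_eq_smul_one, ← klGen, x_eq_klGen_sub,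
    sub_sub, ← add_smul, mul_sub, mul_smul_comm, mul_one] at quadratic
  exact sub_eq_zero.1 quadratic

theorem Hecke.aeval_braidPoly_mul_sub (hv : v ≠ 0) :
    aeval (pairCasimir (v + v⁻¹) (Hecke.klGen n v 0) (Hecke.klGen n v 1)) (braidPoly F n) *
      (Hecke.klGen n v 0 - Hecke.klGen n v 1) = 0 := by
  rw [← altL_sub_altL hv (klGen_mul_self 0) (klGen_mul_self 1), ← x_eq_klGen_sub,
    ← x_eq_klGen_sub, x_braid, sub_self]

variable (n) in
theorem Hecke.exists_algHom_klGen_eq {A : Type*} [Ring A] [Algebra F A] (hv : v ≠ 0) {a b : A}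
    (ha : a * a = (v + v⁻¹) • a) (hb : b * b = (v + v⁻¹) • b)
    (hab : aeval (pairCasimir (v + v⁻¹) a b) (braidPoly F n) * (a - b) = 0) :
    ∃ φ : Hecke n v →ₐ[F] A, φ (Hecke.klGen n v 0) = a ∧ φ (Hecke.klGen n v 1) = b := by
  have quadratic {z : A} (hz : z * z = (v + v⁻¹) • z) :
      (z - v • 1 + algebraMap F A v) * (z - v • 1 - algebraMap F A v⁻¹) = 0 := by
    rw [Algebra.algebraMap_eq_smul_one, Algebra.algebraMap_eq_smul_one, sub_add_cancel,
      sub_sub, ← add_smul, mul_sub, mul_smul_comm, mul_one, hz, sub_self]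
  let φ : Hecke n v →ₐ[F] A := Hecke.lift n v ![a - v • 1, b - v • 1] fun x y hxy => by
    cases hxy with
    | braid =>
      rw [← sub_eq_zero]
      simpa [map_altL] using (altL_sub_altL hv ha hb n).trans hab
    | quadratic i => fin_cases i; exacts [by simpa using quadratic ha, by simpa using quadratic hb]
  have φ_x (i : Fin 2) : φ (Hecke.x n v i) = ![a - v • 1, b - v • 1] i :=
    (Hecke.lift_mk ..).trans (FreeAlgebra.lift_ι_apply _ i)
  exact ⟨φ, by simp [klGen, φ_x], by simp [klGen, φ_x]⟩

theorem Hecke.rev_one : Hecke.rev n v 1 = 1 := by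
  simpa only [map_one] using Hecke.rev_algebraMap (n := n) (v := v) 1

theorem Hecke.rev_klGen (i : Fin 2) : Hecke.rev n v (Hecke.klGen n v i) = Hecke.klGen n v i := by
  rw [klGen, map_add, rev_x, map_smul, rev_one]

end KazhdanLusztigGenerators

section HeckeCells

variable {F : Type*} [Field F] {n : ℕ} {v : F} {c : ℕ → F}

variable (n v c) in
/-- The cell basis of the dihedral Hecke algebra in the Kazhdan–Lusztig generators; the `c j` are
meant to be the roots of the braid polynomial. -/
noncomputable def heckeCell : ∀ μ : DihedralCell n, Fin μ.size → Fin μ.size → Hecke n v :=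
  pairCell n (v + v⁻¹) c (Hecke.klGen n v 0) (Hecke.klGen n v 1)

theorem Hecke.rev_casimirProd (k : ℕ) :
    Hecke.rev n v (casimirProd (v + v⁻¹) c (klGen n v 0) (klGen n v 1) k) =
      casimirProd (v + v⁻¹) c (klGen n v 0) (klGen n v 1) k := by
  have rev_pairCasimir : Hecke.rev n v (pairCasimir (v + v⁻¹) (klGen n v 0) (klGen n v 1)) =
      pairCasimir (v + v⁻¹) (klGen n v 0) (klGen n v 1) := by
    simp only [pairCasimir, map_add, map_sub, map_smul, rev_mul, rev_klGen, rev_one]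
    rw [add_comm (klGen n v 1 * klGen n v 0)]
  induction k with
  | zero => rw [casimirProd_zero, rev_one]
  | succ k ih =>
    rw [casimirProd_succ, rev_mul, ih, map_sub, rev_pairCasimir, map_smul, rev_one]
    exact ((commute_casimirProd (Commute.refl _) k).sub_right
      ((Commute.one_right _).smul_right (c k))).symm.eq

theorem Hecke.rev_heckeCell (μ : DihedralCell n) (S T : Fin μ.size) :
    Hecke.rev n v (heckeCell n v c μ S T) = heckeCell n v c μ T S := by
  have comm₀ (k : ℕ) := commute_casimirProd_left (c := c) (b := klGen n v 1)
    (klGen_mul_self (n := n) (v := v) 0) k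
  have comm₁ (k : ℕ) := commute_casimirProd_right (c := c) (a := klGen n v 0)
    (klGen_mul_self (n := n) (v := v) 1) k
  induction μ using DihedralCell.cases with
  | bot =>
    change Hecke.rev n v (casimirProd _ c _ _ n * klGen n v 0) = casimirProd _ c _ _ n * klGen n v 0
    rw [rev_mul, rev_klGen, rev_casimirProd, (comm₀ n).eq]
  | top => exact rev_one
  | middle k =>
    have rev_word (i : Fin 2) : Hecke.rev n v (![1, klGen n v 1] i) = ![1, klGen n v 1] i := by
      fin_cases i
      exacts [rev_one, rev_klGen 1]
    have comm_word (i : Fin 2) : Commute (casimirProd (v + v⁻¹) c (klGen n v 0) (klGen n v 1) k)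
        (![1, klGen n v 1] i) := by
      fin_cases i
      exacts [Commute.one_right _, comm₁ k]
    have rev_middle (S T : Fin 2) :
        Hecke.rev n v (casimirProd (v + v⁻¹) c (klGen n v 0) (klGen n v 1) k *
          (![1, klGen n v 1] S * klGen n v 0 * ![1, klGen n v 1] T)) =
        casimirProd (v + v⁻¹) c (klGen n v 0) (klGen n v 1) k *
          (![1, klGen n v 1] T * klGen n v 0 * ![1, klGen n v 1] S) := by
      simp only [rev_mul, rev_casimirProd, rev_word, rev_klGen, ← mul_assoc _ (klGen n v 0)]
      exact (((comm_word T).mul_right (comm₀ k)).mul_right (comm_word S)).symm.eq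
    exact rev_middle S T

theorem casimirProd_mul_klGen (hv : v ≠ 0)
    (hQ : braidPoly F n = ∏ j ∈ Finset.range n, (X - C (c j))) :
    casimirProd (v + v⁻¹) c (Hecke.klGen n v 0) (Hecke.klGen n v 1) n * Hecke.klGen n v 0 =
      casimirProd (v + v⁻¹) c (Hecke.klGen n v 0) (Hecke.klGen n v 1) n * Hecke.klGen n v 1 := by
  rw [← sub_eq_zero, ← mul_sub, casimirProd, ← hQ, Hecke.aeval_braidPoly_mul_sub hv]

theorem actsOnCells_heckeCell (hv : v ≠ 0)
    (hQ : braidPoly F n = ∏ j ∈ Finset.range n, (X - C (c j))) (hc : ∀ j < n, c j ≠ 0)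
    (a : Hecke n v) : ActsOnCells F (heckeCell n v c) a := by
  have equalize := casimirProd_mul_klGen hv hQ
  have acts_klGen (i : Fin 2) : ActsOnCells F (heckeCell n v c) (Hecke.klGen n v i) := by
    fin_cases i
    · exact actsOnCells_pairCell_left (Hecke.klGen_mul_self 0) (Hecke.klGen_mul_self 1) equalize
    · exact actsOnCells_pairCell_right (Hecke.klGen_mul_self 1) hc equalize
  induction a using Hecke.induction with
  | halg r => exact actsOnCells_algebraMap r
  | hadd a b ha hb => exact ha.add hb
  | hmul a b ha hb => exact ha.mul hb
  | hx i =>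
    rw [Hecke.x_eq_klGen_sub, sub_eq_add_neg, ← neg_smul, ← Algebra.algebraMap_eq_smul_one]
    exact (acts_klGen i).add (actsOnCells_algebraMap _)

theorem exists_separatesCell_top (hv : v ≠ 0) :
    ∃ φ : Hecke n v →ₗ[F] Matrix (Fin 2) (Fin 2) F, SeparatesCell (heckeCell n v c) φ ⊤ := by
  obtain ⟨φ, h₀, h₁⟩ := Hecke.exists_algHom_klGen_eq n (v := v) hv (a := 0)
    (b := (0 : Matrix (Fin 2) (Fin 2) F)) (by simp) (by simp) (by simp)
  refine ⟨φ.toLinearMap, fun κ hκ S T => ?_, ?_⟩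
  · refine (map_pairCell φ κ S T).trans ?_
    rw [h₀, h₁]
    induction κ using DihedralCell.cases with
    | bot => exact mul_zero _
    | top => exact absurd hκ (lt_irrefl _)
    | middle k =>
      change casimirProd _ c _ _ k * ((![1, 0] : Fin 2 → Matrix (Fin 2) (Fin 2) F) _ * 0 * _) = 0
      rw [mul_zero, zero_mul, mul_zero]
  · have image_ne_zero : φ 1 ≠ 0 := (map_one φ).trans_ne one_ne_zero
    exact LinearIndependent.of_subsingleton (ι := Fin 1 × Fin 1) (0, 0) image_ne_zero

theorem exists_separatesCell_bot (hv : v ≠ 0) (hδ : v + v⁻¹ ≠ 0)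
    (hcδ : ∀ j < n, (v + v⁻¹) ^ 2 ≠ c j) :
    ∃ φ : Hecke n v →ₗ[F] Matrix (Fin 2) (Fin 2) F, SeparatesCell (heckeCell n v c) φ ⊥ := by
  have square : ((v + v⁻¹) • 1 : Matrix (Fin 2) (Fin 2) F) * ((v + v⁻¹) • 1) =
      (v + v⁻¹) • (v + v⁻¹) • 1 := by rw [smul_mul_assoc, one_mul]
  obtain ⟨φ, h₀, h₁⟩ := Hecke.exists_algHom_klGen_eq n hv square square
    (by rw [sub_self, mul_zero])
  refine ⟨φ.toLinearMap, fun κ hκ => absurd hκ not_lt_bot,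
    LinearIndependent.of_subsingleton (ι := Fin 1 × Fin 1) (0, 0) ?_⟩
  have factors_ne_zero : ∏ j ∈ Finset.range n, ((v + v⁻¹) ^ 2 - c j) ≠ 0 :=
    Finset.prod_ne_zero_iff.2 fun j hj => sub_ne_zero.2 (hcδ j (Finset.mem_range.1 hj))
  change φ (casimirProd (v + v⁻¹) c (Hecke.klGen n v 0) (Hecke.klGen n v 1) n *
    Hecke.klGen n v 0) ≠ 0
  rw [map_mul, map_casimirProd, h₀, h₁, casimirProd_eq_algebraMap (pairCasimir_smul_one _),
    ← Algebra.smul_def]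
  exact smul_ne_zero factors_ne_zero (smul_ne_zero hδ one_ne_zero)

theorem exists_separatesCell_middle (hv : v ≠ 0)
    (hQ : braidPoly F n = ∏ j ∈ Finset.range n, (X - C (c j))) (hinj : Set.InjOn c (Finset.range n))
    (k : Fin n) (hc : c k ≠ 0) (hcδ : (v + v⁻¹) ^ 2 ≠ c k) :
    ∃ φ : Hecke n v →ₗ[F] Matrix (Fin 2) (Fin 2) F,
      SeparatesCell (heckeCell n v c) φ (DihedralCell.middle k) := by
  have root : (braidPoly F n).eval (c k) = 0 := by
    rw [hQ, eval_prod, Finset.prod_eq_zero (Finset.mem_range.2 k.2)]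
    rw [eval_sub, eval_X, eval_C, sub_self]
  obtain ⟨φ, h₀, h₁⟩ := Hecke.exists_algHom_klGen_eq n hv (cellMatrixLeft_mul_self _ (c k))
    (cellMatrixRight_mul_self _) (by rw [pairCasimir_cellMatrix, aeval_algebraMap_apply,
      coe_aeval_eq_eval, root, map_zero, zero_mul])
  refine ⟨φ.toLinearMap, fun κ hκ S T => ?_, ?_⟩
  · have killed (i : ℕ) (hi : k < i) (w : Matrix (Fin 2) (Fin 2) F) : casimirProd (v + v⁻¹) c
        (cellMatrixLeft (v + v⁻¹) (c k)) (cellMatrixRight (v + v⁻¹)) i * w = 0 := by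
      rw [casimirProd_eq_algebraMap (pairCasimir_cellMatrix _ _),
        Finset.prod_eq_zero (Finset.mem_range.2 hi) (sub_self _),
        map_zero, zero_mul]
    refine (map_pairCell φ κ S T).trans ?_
    rw [h₀, h₁]
    induction κ using DihedralCell.cases with
    | bot => exact killed n k.2 _
    | top => exact absurd hκ (DihedralCell.middle_lt_top k).not_gt
    | middle i => exact killed i (DihedralCell.middle_lt_middle.1 hκ) _
  · have distinct (j : ℕ) (hj : j < k) : c j ≠ c k :=
      hinj.ne (Finset.mem_range.2 (hj.trans k.2)) (Finset.mem_range.2 k.2) hj.ne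
    have independent := linearIndependent_pairCell_cellMatrix hc hcδ distinct
    simp only [← h₀, ← h₁, ← map_pairCell] at independent
    exact independent

theorem linearIndependent_heckeCell (hv : v ≠ 0)
    (hQ : braidPoly F n = ∏ j ∈ Finset.range n, (X - C (c j))) (hc : ∀ j < n, c j ≠ 0)
    (hinj : Set.InjOn c (Finset.range n)) (hδ : v + v⁻¹ ≠ 0)
    (hcδ : ∀ j < n, (v + v⁻¹) ^ 2 ≠ c j) :
    LinearIndependent F fun x : (Σ μ : DihedralCell n, Fin μ.size × Fin μ.size) =>
      heckeCell n v c x.1 x.2.1 x.2.2 := by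
  refine linearIndependent_of_separatesCell (W := Matrix (Fin 2) (Fin 2) F) fun μ => ?_
  induction μ using DihedralCell.cases with
  | bot => exact exists_separatesCell_bot hv hδ hcδ
  | top => exact exists_separatesCell_top hv
  | middle k => exact exists_separatesCell_middle hv hQ hinj k (hc k k.2) (hcδ k k.2)

theorem isCellDatum_heckeCell (hv : v ≠ 0)
    (hQ : braidPoly F n = ∏ j ∈ Finset.range n, (X - C (c j))) (hc : ∀ j < n, c j ≠ 0)
    (hinj : Set.InjOn c (Finset.range n)) (hδ : v + v⁻¹ ≠ 0)
    (hcδ : ∀ j < n, (v + v⁻¹) ^ 2 ≠ c j) :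
    IsCellDatum (DihedralCell n) (fun μ => Fin μ.size) (heckeCell n v c) (Hecke.rev n v) := by
  have independent := linearIndependent_heckeCell hv hQ hc hinj hδ hcδ
  have acts := actsOnCells_heckeCell hv hQ hc
  have spans (a : Hecke n v) : a ∈ cellSpan F (heckeCell n v c) Set.univ := by
    have one_mem : (1 : Hecke n v) ∈ cellSpan F (heckeCell n v c) Set.univ :=
      mem_cellSpan (Set.mem_univ (⊤ : DihedralCell n)) (0 : Fin 1) (0 : Fin 1)
    simpa only [mul_one] using (acts a).mul_mem_cellSpan isLowerSet_univ one_mem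
  exact ⟨independent.injective, independent,
    cellSpan_univ.symm.trans (Submodule.eq_top_iff'.2 spans), Hecke.rev_mul,
    Hecke.rev_rev, Hecke.rev_heckeCell, acts⟩

end HeckeCells

section RootsOfUnity

variable {F K : Type*} [Field F] [Field K] [Algebra F K] {n : ℕ} {ζ : K}

theorem pow_add_inv_pow_mem_range (hζ : ζ ≠ 0) (h : ζ + ζ⁻¹ ∈ (algebraMap F K).range) (k : ℕ) :
    ζ ^ k + (ζ ^ k)⁻¹ ∈ (algebraMap F K).range := by
  induction k using Nat.twoStepInduction with
  | zero => simpa only [pow_zero, inv_one] using add_mem (one_mem _) (one_mem _)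
  | one => simpa only [pow_one] using h
  | more k ih ih' =>
    have recurrence : ζ ^ (k + 2) + (ζ ^ (k + 2))⁻¹ =
        (ζ + ζ⁻¹) * (ζ ^ (k + 1) + (ζ ^ (k + 1))⁻¹) - (ζ ^ k + (ζ ^ k)⁻¹) := by
      field_simp
      ring
    exact recurrence ▸ sub_mem (mul_mem h ih') ih

theorem add_inv_eq_add_inv_iff {x y : K} (hx : x ≠ 0) (hy : y ≠ 0) :
    x + x⁻¹ = y + y⁻¹ ↔ x = y ∨ x * y = 1 := by
  have factored : x + x⁻¹ - (y + y⁻¹) = (x - y) * (x * y - 1) * (x * y)⁻¹ := by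
    field_simp
    ring
  rw [← sub_eq_zero, factored, mul_eq_zero_iff_right (inv_ne_zero (mul_ne_zero hx hy)),
    mul_eq_zero, sub_eq_zero, sub_eq_zero]

/-- For a primitive `(2n + 1)`-st root of unity `ζ`, the values at `j < n` are the roots of
`braidPoly K n`. -/
def braidRoot (ζ : K) (j : ℕ) : K := 2 + (ζ ^ (j + 1) + (ζ ^ (j + 1))⁻¹)

theorem braidRoot_injOn (hζ : IsPrimitiveRoot ζ (2 * n + 1)) :
    Set.InjOn (braidRoot ζ) (Finset.range n) := by
  intro i hi j hj hij
  rw [Finset.coe_range, Set.mem_Iio] at hi hj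
  have hpow (k : ℕ) : ζ ^ k ≠ 0 := pow_ne_zero k (hζ.ne_zero (by omega))
  rcases (add_inv_eq_add_inv_iff (hpow _) (hpow _)).1 (add_left_cancel hij) with heq | hmul
  · exact Nat.succ_injective (hζ.pow_inj (by omega) (by omega) heq)
  · rw [← pow_add] at hmul
    exact absurd hmul (hζ.pow_ne_one_of_pos_of_lt (by omega) (by omega))

theorem isRoot_braidPoly_braidRoot (hζ : IsPrimitiveRoot ζ (2 * n + 1)) {j : ℕ} (hj : j < n) :
    (braidPoly K n).IsRoot (braidRoot ζ j) := by
  have hpow : ζ ^ (j + 1) ≠ 0 := pow_ne_zero _ (hζ.ne_zero (by omega))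
  have value := eval_braidPoly hpow n
  rw [pow_right_comm ζ (j + 1) (2 * n + 1), hζ.pow_eq_one, one_pow, sub_self, add_assoc] at value
  have hne : ζ ^ (j + 1) - 1 ≠ 0 :=
    sub_ne_zero.2 (hζ.pow_ne_one_of_pos_of_lt (by omega) (by omega))
  exact (mul_eq_zero.1 ((mul_eq_zero.1 value).resolve_left hne)).resolve_left (pow_ne_zero n hpow)

theorem braidPoly_eq_prod_braidRoot (hζ : IsPrimitiveRoot ζ (2 * n + 1)) :
    braidPoly K n = ∏ j ∈ Finset.range n, (X - C (braidRoot ζ j)) :=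
  eq_prod_X_sub_C_of_isMonicOfDegree
    ((Finset.card_range n).symm ▸ isMonicOfDegree_braidPoly K n) (braidRoot_injOn hζ)
    fun _ hj => isRoot_braidPoly_braidRoot hζ (Finset.mem_range.1 hj)

theorem braidRoot_ne_zero (h2 : (2 : K) ≠ 0) (hζ : IsPrimitiveRoot ζ (2 * n + 1)) (j : ℕ) :
    braidRoot ζ j ≠ 0 := by
  intro hzero
  have hpow : ζ ^ (j + 1) ≠ 0 := pow_ne_zero _ (hζ.ne_zero (by omega))
  have square : (ζ ^ (j + 1) + 1) ^ 2 = ζ ^ (j + 1) * braidRoot ζ j := by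
    rw [braidRoot]
    field_simp
    ring
  rw [hzero, mul_zero, sq_eq_zero_iff] at square
  have order : (ζ ^ (j + 1)) ^ (2 * n + 1) = 1 := by
    rw [pow_right_comm, hζ.pow_eq_one, one_pow]
  rw [eq_neg_of_add_eq_zero_left square, (odd_two_mul_add_one n).neg_one_pow] at order
  exact h2 (by linear_combination -order)

theorem add_inv_sq_ne_braidRoot (hζ : IsPrimitiveRoot ζ (2 * n + 1)) {v : K} (hv : v ≠ 0)
    (hvn : v ^ (2 * (2 * n + 1)) ≠ 1) (j : ℕ) : (v + v⁻¹) ^ 2 ≠ braidRoot ζ j := by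
  intro heq
  have hpow : ζ ^ (j + 1) ≠ 0 := pow_ne_zero _ (hζ.ne_zero (by omega))
  have order : (ζ ^ (j + 1)) ^ (2 * n + 1) = 1 := by
    rw [pow_right_comm, hζ.pow_eq_one, one_pow]
  have square : (v + v⁻¹) ^ 2 = 2 + (v ^ 2 + (v ^ 2)⁻¹) := by
    field_simp
    ring
  rw [square, braidRoot, add_right_inj, add_inv_eq_add_inv_iff (pow_ne_zero 2 hv) hpow] at heq
  refine hvn ((pow_mul v 2 _).trans ?_)
  rcases heq with heq | hmul
  · rw [heq, order]
  · rw [eq_inv_of_mul_eq_one_left hmul, inv_pow, order, inv_one]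

theorem exists_isCellDatum_heckeCell {v : F} (h2 : (2 : F) ≠ 0) (hv : v ≠ 0)
    (hδ : v + v⁻¹ ≠ 0) (hvn : v ^ (2 * (2 * n + 1)) ≠ 1) (hζ : IsPrimitiveRoot ζ (2 * n + 1))
    (h : ζ + ζ⁻¹ ∈ (algebraMap F K).range) :
    ∃ c, IsCellDatum (DihedralCell n) (fun μ => Fin μ.size) (heckeCell n v c) (Hecke.rev n v) := by
  have inj := (algebraMap F K).injective
  have h2K : (2 : K) ≠ 0 := map_ofNat (algebraMap F K) 2 ▸ (map_ne_zero_iff _ inj).2 h2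
  have braidRoot_mem (j : ℕ) : braidRoot ζ j ∈ (algebraMap F K).range :=
    add_mem (ofNat_mem _ 2) (pow_add_inv_pow_mem_range (hζ.ne_zero (by omega)) h (j + 1))
  choose c hc using braidRoot_mem
  refine ⟨c, isCellDatum_heckeCell hv ?_ (fun j _ => ?_) (fun i hi j hj hij => ?_) hδ
    fun j _ => ?_⟩
  · apply map_injective _ inj
    simp only [braidPoly_map, braidPoly_eq_prod_braidRoot hζ, Polynomial.map_prod,
      Polynomial.map_sub, map_X, map_C, hc]
  · exact (map_ne_zero_iff _ inj).1 (hc j ▸ braidRoot_ne_zero h2K hζ j)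
  · exact braidRoot_injOn hζ hi hj (by rw [← hc, ← hc, hij])
  · refine inj.ne_iff.1 ?_
    rw [hc, map_pow, map_add, map_inv₀]
    refine add_inv_sq_ne_braidRoot hζ ((map_ne_zero_iff _ inj).2 hv) ?_ j
    rwa [← map_pow, map_ne_one_iff _ inj]

end RootsOfUnity

end DihedralBMW

theorem mainTheorem7_general (n : ℕ) (F : Type*) [Field F] (v l : F) (h2 : (2 : F) ≠ 0)
    (hv : v ≠ 0) (hm : v - v⁻¹ ≠ 0) (hl : l ≠ 0)
    (hdet : (DihedralBMW.lkGram (2 * n + 1) (v - v⁻¹) l).det ≠ 0) :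
    (∀ (Λ : Type*) [PartialOrder Λ] (M : Λ → Type) [∀ μ, Fintype (M μ)]
      [∀ μ, LinearOrder (M μ)] (C : ∀ μ, M μ → M μ → DihedralBMW.Hecke n v)
      (D : ∀ μ, M μ → M μ → DihedralBMW.BMW n (v - v⁻¹) l),
      DihedralBMW.IsCellDatum Λ M C (DihedralBMW.Hecke.rev n v) →
      (∀ (μ : Λ) (S T : M μ), S ≤ T →
        DihedralBMW.toHecke n v l hv (D μ S T) = C μ S T) →
      DihedralBMW.IsCellDatum (WithBot Λ) (DihedralBMW.cellIndex n M)
          (DihedralBMW.cellElement n (v - v⁻¹) l M D) (DihedralBMW.BMW.rev n (v - v⁻¹) l) ∧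
        ∀ (μ : Λ) (S T : M μ), DihedralBMW.toHecke n v l hv
          (DihedralBMW.cellElement n (v - v⁻¹) l M D (μ : WithBot Λ) S T) = C μ S T) ∧
    (v + v⁻¹ ≠ 0 → v ^ (2 * (2 * n + 1)) ≠ 1 →
      ∀ (K : Type*) [Field K] [Algebra F K],
        (∃ ζ : K, IsPrimitiveRoot ζ (2 * n + 1) ∧ ζ + ζ⁻¹ ∈ Set.range (algebraMap F K)) →
          DihedralBMW.IsCellularWith (DihedralBMW.Hecke.rev n v) ∧
            DihedralBMW.IsCellularWith (DihedralBMW.BMW.rev n (v - v⁻¹) l)) := by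
  refine ⟨fun Λ _ M _ _ C D hC hD => ⟨DihedralBMW.isCellDatum_cellElement h2 hv hm hl hdet hC hD,
    DihedralBMW.toHecke_cellElement h2 hv hC hD⟩, ?_⟩
  rintro hδ hvn K _ _ ⟨ζ, hζ, h⟩
  obtain ⟨c, hC⟩ := DihedralBMW.exists_isCellDatum_heckeCell h2 hv hδ hvn hζ h
  choose D hD using fun μ S T =>
    DihedralBMW.toHecke_surjective (l := l) hv (DihedralBMW.heckeCell n v c μ S T)
  exact ⟨⟨_, _, _, _, _, hC⟩, ⟨_, _, _, _, _,
    DihedralBMW.isCellDatum_cellElement h2 hv hm hl hdet hC fun μ S T _ => hD μ S T⟩⟩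

theorem mainTheorem7 (n : ℕ) (hn : 1 ≤ n) (F : Type*) [Field F] [CharZero F] (v l : F)
    (hv : v ≠ 0) (hvl : AlgebraicIndependent ℚ ![v, l]) :
    -- every cell datum of the Hecke algebra with word reversal lifts, for every choice of lifts
    (∀ (Λ : Type*) [PartialOrder Λ] (M : Λ → Type) [∀ μ, Fintype (M μ)]
      [∀ μ, LinearOrder (M μ)] (C : ∀ μ, M μ → M μ → DihedralBMW.Hecke n v)
      (D : ∀ μ, M μ → M μ → DihedralBMW.BMW n (v - v⁻¹) l),
      DihedralBMW.IsCellDatum Λ M C (DihedralBMW.Hecke.rev n v) →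
      (∀ (μ : Λ) (S T : M μ), S ≤ T →
        DihedralBMW.toHecke n v l hv (D μ S T) = C μ S T) →
      DihedralBMW.IsCellDatum (WithBot Λ) (DihedralBMW.cellIndex n M)
          (DihedralBMW.cellElement n (v - v⁻¹) l M D) (DihedralBMW.BMW.rev n (v - v⁻¹) l) ∧
        ∀ (μ : Λ) (S T : M μ), DihedralBMW.toHecke n v l hv
          (DihedralBMW.cellElement n (v - v⁻¹) l M D (μ : WithBot Λ) S T) = C μ S T) ∧
    -- if `F` contains `ζ + ζ⁻¹`, both algebras are cellular with respect to word reversal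
    ((∃ ζ : AlgebraicClosure F, IsPrimitiveRoot ζ (2 * n + 1) ∧
        ζ + ζ⁻¹ ∈ Set.range (algebraMap F (AlgebraicClosure F))) →
      DihedralBMW.IsCellularWith (DihedralBMW.Hecke.rev n v) ∧
        DihedralBMW.IsCellularWith (DihedralBMW.BMW.rev n (v - v⁻¹) l)) := by
  obtain ⟨lift, cellular⟩ := mainTheorem7_general n F v l two_ne_zero hv
    (DihedralBMW.sub_inv_ne_zero_of_algebraicIndependent hvl) (hvl.ne_zero 1)
    (DihedralBMW.det_lkGram_ne_zero hvl _)
  exact ⟨lift, cellular (DihedralBMW.add_inv_ne_zero_of_algebraicIndependent hvl)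
    (DihedralBMW.pow_ne_one_of_algebraicIndependent hvl (by omega)) _⟩
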